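/- Let $(R,M,\psi,\Phi)$ be a form ring in the sense of Nebe, Rains and Sloane, and let $\rho=(V,\rho_M,\rho_\Phi,\beta)$ be a finite representation of it: $V$ is a finite left $R$-module, $\beta=\rho_M(\psi(1))$ is a non-singular bi-additive form $V\times V\to\mathbb{Q}/\mathbb{Z}$, and the elements of $\Phi$ act as $\mathbb{Q}/\mathbb{Z}$-valued quadratic maps $\rho_\Phi(\phi)$ on $V$. A code of Type $\rho$ is an $R$-submodule $C\le V$ with $C=C^{\perp}$ with respect to $\beta$ and $\rho_\Phi(\phi)(C)=\{0\}$ for all $\phi\in\Phi$. Denote by $J$ the anti-automorphism $r^J=\psi^{-1}(\psi(1)(r\otimes 1))$ of $R$. The Clifford-Weil group $\mathcal{C}(\rho)$ is the group of linear automorphisms of $\mathbb{C}V=\bigoplus_{w\in V}\mathbb{C}b_w$ generated by $$m_r:b_w\mapsto b_{rw},\quad d_\phi:b_w\mapsto e^{2\pi i\rho_\Phi(\phi)(w)}b_w,\quad h_{\iota,u,v}:b_w\mapsto |\iota V|^{-1/2}\sum_{y\in\iota V}e^{2\pi i\beta(y,vw)}\,b_{y+(1-\iota)w}$$ for $r\in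 R^\times$, $\phi\in\Phi$ and symmetric idempotents $\iota=uv\in R$, where $u\in \iota R\iota^J$, $v\in\iota^JR\iota$ and $vu=\iota^J$. The Weight Enumerator Conjecture for $\rho$ is the assertion that the fixed space of $\mathcal{C}(\rho)$ in $\mathbb{C}V$ is spanned by the full weight enumerators $\sum_{c\in C}b_c$ of the codes $C$ of Type $\rho$. Let $\rho^{(N,N)}$ be the representation on $V^{N+N}$ that is the orthogonal sum of $N$ copies of $\rho$ and $N$ copies of $\rho^{(-1)}=(V,-\rho_M,-\rho_\Phi,-\beta)$; codes of Type $\rho^{(N,N)}$ are called codes of Type $(N,N)$. For $m\ge 0$ let $R^m\otimes\rho$ be the representation on $V^m$ of the matrix form ring $\mathrm{Mat}_m(R,M,\psi,\Phi)$, and put $\mathcal{C}_m(\rho)=\mathcal{C}(R^m\otimes\rho)$. It acts diagonally on $W=\mathbb{C}(V^m)^N=\bigotimes^N\mathbb{C}(V^m)$. For $C\le V^{N+N}$ put $$\mathrm{fwe}_m^{(N,N)}(C)=\sum_{c\in C^m}b_{(c_1,\ldots,c_N)}\otimes b^*_{(c_{N+1},\ldots,c_{2N})}\in W\otimes W^*,$$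 where $c_i\in V^m$ is the $i$-th column of $c$, viewed as a matrix whose rows are $m$ codewords of $C$, and $(b^*_w)$ is the basis dual to $(b_w)$. Let $\varphi:W\otimes W^*\to\mathrm{End}_{\mathbb{C}}(W)$ be the isomorphism $w\otimes f\mapsto(x\mapsto f(x)w)$. Let $C_1,\ldots,C_{t_N}$ be the complete list of all codes of Type $(N,N)$ in $V^{N+N}$, and let $g_N(\rho)\in\mathbb{N}$ be such that every code of Type $(N,N)$ can be generated, as an $R$-module, by $g_N(\rho)$ elements. Let $m\ge g_N(\rho)$ and assume that the Weight Enumerator Conjecture holds for the representation $(R^m\otimes\rho)^{(N,N)}$. Then $$\bigl(\varphi(\mathrm{fwe}_m^{(N,N)}(C_1)),\ldots,\varphi(\mathrm{fwe}_m^{(N,N)}(C_{t_N}))\bigr)$$ is a basis of the commuting algebra $\mathrm{End}_{\mathcal{C}_m(\rho)}(\mathbb{C}(V^m)^N)$. In particular the dimension of this algebra is $t_N$, a number that does not depend on $m$. -/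

import Mathlib

open scoped TensorProduct Matrix.Module

noncomputable section

/-! ### Values in `ℚ/ℤ` -/

/-- The group `ℚ/ℤ`. -/
abbrev QZ : Type := AddCircle (1 : ℚ)

/-- The character `x ↦ exp (2 π i x)` of `ℚ/ℤ`. -/
def qzExp : QZ → ℂ :=
  Function.Periodic.lift (c := (1 : ℚ))
    (f := fun q : ℚ => Complex.exp (2 * Real.pi * Complex.I * (q : ℂ))) (by
      intro q
      have h : (2 * Real.pi * Complex.I * ((q + 1 : ℚ) : ℂ) : ℂ)
          = 2 * Real.pi * Complex.I * (q : ℂ) + 2 * Real.pi * Complex.I := by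
        push_cast; ring
      simp only [h]
      rw [Complex.exp_add, Complex.exp_two_pi_mul_I, mul_one])

theorem qzExp_coe (q : ℚ) :
    qzExp (q : QZ) = Complex.exp (2 * Real.pi * Complex.I * (q : ℂ)) := rfl

theorem qzExp_add (x y : QZ) : qzExp (x + y) = qzExp x * qzExp y := by
  induction x using QuotientAddGroup.induction_on with | H p
  induction y using QuotientAddGroup.induction_on with | H q
  rw [← QuotientAddGroup.mk_add]
  change qzExp ((p + q : ℚ) : QZ) = qzExp (p : QZ) * qzExp (q : QZ)
  rw [qzExp_coe, qzExp_coe, qzExp_coe, ← Complex.exp_add]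
  push_cast; ring_nf

theorem qzExp_zero : qzExp 0 = 1 := by
  have h := qzExp_coe 0
  simpa using h

theorem qzExp_eq_one {x : QZ} (h : qzExp x = 1) : x = 0 := by
  induction x using QuotientAddGroup.induction_on with | H q
  change Complex.exp (2 * Real.pi * Complex.I * (q : ℂ)) = 1 at h
  obtain ⟨n, hn⟩ := Complex.exp_eq_one_iff.1 h
  rw [QuotientAddGroup.eq_zero_iff, AddSubgroup.mem_zmultiples_iff]
  refine ⟨n, ?_⟩
  rw [mul_comm] at hn
  have h2 := mul_right_cancel₀ Complex.two_pi_I_ne_zero hn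
  have h3 : q = (n : ℚ) := by exact_mod_cast h2
  simp [h3]

/-! ### Form rings -/

/-- A form ring `(R, M, ψ, Φ)`. The right `R ⊗ R`-module structure of `M` is given by the maps
`act r s : m ↦ m (r ⊗ s)`, and the qmodule structure of `Φ` by the maps `br r : φ ↦ φ[r]`.
That `[]` is a pointed quadratic map follows from `brace_lam`. -/
structure FormRing (R M Φ : Type*) [Ring R] [AddCommGroup M] [AddCommGroup Φ] where
  act : R →+ R →+ M →+ M
  act_one : ∀ m, act 1 1 m = m
  act_mul : ∀ r r' s s' m, act (r * r') (s * s') m = act r' s' (act r s m)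
  /-- `ψ : R_R → M_{1 ⊗ R}`, an isomorphism of right `R`-modules -/
  psi : R ≃+ M
  psi_mul : ∀ r s, psi (r * s) = act 1 s (psi r)
  tau : M →+ M
  tau_tau : ∀ m, tau (tau m) = m
  tau_act : ∀ r s m, act s r (tau m) = tau (act r s m)
  isUnit_eps : IsUnit (psi.symm (tau (psi 1)))
  br : R → AddMonoid.End Φ
  br_one : ∀ φ, br 1 φ = φ
  br_mul : ∀ r s φ, br (r * s) φ = br s (br r φ)
  /-- the qmodule homomorphism `{{ }} : M → Φ` -/
  brace : M →+ Φ
  brace_br : ∀ r m, brace (act r r m) = br r (brace m)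
  /-- the qmodule homomorphism `λ : Φ → M` -/
  lam : Φ →+ M
  lam_br : ∀ r φ, lam (br r φ) = act r r (lam φ)
  brace_tau : ∀ m, brace (tau m) = brace m
  tau_lam : ∀ φ, tau (lam φ) = lam φ
  lam_brace : ∀ m, lam (brace m) = m + tau m
  brace_lam : ∀ r s φ, brace (act r s (lam φ)) = br (r + s) φ - br r φ - br s φ

namespace FormRing

section Basic

variable {R M Φ : Type*} [Ring R] [AddCommGroup M] [AddCommGroup Φ] (F : FormRing R M Φ)

/-- The anti-automorphism `r ↦ r^J = ψ⁻¹ (ψ(1) (r ⊗ 1))` of `R`. -/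
def J (r : R) : R := F.psi.symm (F.act r 1 (F.psi 1))

/-- `ι = u v` is a symmetric idempotent, where `v ∈ ι^J R ι` and `u ∈ ι R ι^J` are mutually
inverse in the sense that `u v = ι` and `v u = ι^J`. -/
structure IsSymIdem (ι u v : R) : Prop where
  idem : ι * ι = ι
  memU : ι * u * F.J ι = u
  memV : F.J ι * v * ι = v
  mulUV : u * v = ι
  mulVU : v * u = F.J ι

theorem psi_J (r : R) : F.psi (F.J r) = F.act r 1 (F.psi 1) := by simp [J]

theorem act_psi_one (r s : R) : F.act r s (F.psi 1) = F.act 1 (F.J r * s) (F.psi 1) := by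
  have h := F.act_mul 1 1 (F.J r) s (F.psi 1)
  rw [mul_one] at h
  rw [h, ← F.psi_mul, one_mul, psi_J, ← F.act_mul, mul_one, one_mul]

theorem br_zero (φ : Φ) : F.br 0 φ = 0 := by
  have h := F.brace_lam 0 0 φ
  simpa using h

end Basic

/-! ### Matrix rings of form rings -/

section Mat

variable {R M Φ : Type*} [Ring R] [AddCommGroup M] [AddCommGroup Φ] (F : FormRing R M Φ)
variable {m : ℕ}

/-- The qmodule of the matrix form ring: upper triangular `m × m` matrices with entries
in `Φ` on the diagonal and entries in `M` above the diagonal. -/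
abbrev MatPhi (M Φ : Type*) (m : ℕ) : Type _ :=
  (Fin m → Φ) × ({p : Fin m × Fin m // p.1 < p.2} → M)

/-- `λ` of an upper triangular matrix: the `τ`-symmetric matrix with the same entries above the
diagonal and `λ(φ_i)` on the diagonal. -/
def lamMat (φ : MatPhi M Φ m) : Matrix (Fin m) (Fin m) M :=
  Matrix.of fun i k =>
    if h : i < k then φ.2 ⟨(i, k), h⟩
    else if h : k < i then F.tau (φ.2 ⟨(k, i), h⟩)
    else F.lam (φ.1 i)

/-- For a matrix `S` over `M` and columns `a, b` over `R`, this is `∑ S_{ik} (a_i ⊗ b_k)`. -/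
def bilin (S : Matrix (Fin m) (Fin m) M) (a b : Fin m → R) : M :=
  ∑ i, ∑ k, F.act (a i) (b k) (S i k)

/-- For an upper triangular matrix `φ` and a column `a` over `R`, this is
`∑ φ_i[a_i] + ∑_{i<k} {{φ_{ik} (a_i ⊗ a_k)}}`. -/
def quad (φ : MatPhi M Φ m) (a : Fin m → R) : Φ :=
  ∑ i, F.br (a i) (φ.1 i)
    + ∑ i, ∑ k ∈ Finset.Ioi i, F.brace (F.act (a i) (a k) (F.lamMat φ i k))

theorem sum_eq_diag_add {A : Type*} [AddCommGroup A] (f : Fin m → Fin m → A) :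
    ∑ i, ∑ k, f i k = ∑ i, f i i + ∑ i, ∑ k ∈ Finset.Ioi i, (f i k + f k i) := by
  have h1 : ∀ i : Fin m, ∑ k, f i k
      = f i i + (∑ k ∈ Finset.Ioi i, f i k + ∑ k ∈ Finset.Iio i, f i k) := by
    intro i
    have hu : (Finset.univ : Finset (Fin m))
        = insert i (Finset.Ioi i ∪ Finset.Iio i) := by
      ext k
      have := lt_trichotomy k i
      simp only [Finset.mem_univ, Finset.mem_insert, Finset.mem_union, Finset.mem_Ioi,
        Finset.mem_Iio, true_iff]
      tauto
    have hd : Disjoint (Finset.Ioi i) (Finset.Iio i) := by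
      rw [Finset.disjoint_left]; intro k hk hk'
      simp at hk hk'; exact absurd hk (not_lt.2 hk'.le)
    rw [hu, Finset.sum_insert (by simp), Finset.sum_union hd]
  have h2 : ∑ i : Fin m, ∑ k ∈ Finset.Iio i, f i k
      = ∑ i : Fin m, ∑ k ∈ Finset.Ioi i, f k i := by
    apply Finset.sum_comm'
    intro x y; simp
  simp only [h1, Finset.sum_add_distrib, h2]

theorem lamMat_lt (φ : MatPhi M Φ m) {i k : Fin m} (h : i < k) :
    F.lamMat φ i k = φ.2 ⟨(i, k), h⟩ := by simp [lamMat, h]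

theorem lamMat_self (φ : MatPhi M Φ m) (i : Fin m) : F.lamMat φ i i = F.lam (φ.1 i) := by
  simp [lamMat]

theorem tau_lamMat (φ : MatPhi M Φ m) (i k : Fin m) :
    F.tau (F.lamMat φ i k) = F.lamMat φ k i := by
  rcases lt_trichotomy i k with h | h | h
  · simp [lamMat, h, h.not_gt]
  · subst h; simp [lamMat, F.tau_lam]
  · simp [lamMat, h, h.not_gt, F.tau_tau]

theorem lamMat_add (φ χ : MatPhi M Φ m) (i k : Fin m) :
    F.lamMat (φ + χ) i k = F.lamMat φ i k + F.lamMat χ i k := by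
  simp only [lamMat, Matrix.of_apply]; split_ifs <;> simp

theorem lamMat_zero (i k : Fin m) : F.lamMat (0 : MatPhi M Φ m) i k = 0 := by
  simp only [lamMat, Matrix.of_apply]; split_ifs <;> simp

theorem bilin_add_left (S : Matrix (Fin m) (Fin m) M) (a a' b : Fin m → R) :
    F.bilin S (a + a') b = F.bilin S a b + F.bilin S a' b := by
  simp [bilin, Finset.sum_add_distrib]

theorem bilin_add_right (S : Matrix (Fin m) (Fin m) M) (a b b' : Fin m → R) :
    F.bilin S a (b + b') = F.bilin S a b + F.bilin S a b' := by
  simp [bilin, Finset.sum_add_distrib]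

theorem bilin_zero_left (S : Matrix (Fin m) (Fin m) M) (b : Fin m → R) : F.bilin S 0 b = 0 := by
  simp [bilin]

theorem bilin_sum_left {κ : Type*} (s : Finset κ) (S : Matrix (Fin m) (Fin m) M)
    (a : κ → Fin m → R) (b : Fin m → R) :
    F.bilin S (∑ j ∈ s, a j) b = ∑ j ∈ s, F.bilin S (a j) b := by
  classical
  induction s using Finset.induction_on with
  | empty => simp [bilin_zero_left]
  | insert j s hj ih => rw [Finset.sum_insert hj, Finset.sum_insert hj, bilin_add_left, ih]

theorem bilin_sum_right {κ : Type*} (s : Finset κ) (S : Matrix (Fin m) (Fin m) M)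
    (a : Fin m → R) (b : κ → Fin m → R) :
    F.bilin S a (∑ j ∈ s, b j) = ∑ j ∈ s, F.bilin S a (b j) := by
  classical
  induction s using Finset.induction_on with
  | empty => simp [bilin]
  | insert j s hj ih => rw [Finset.sum_insert hj, Finset.sum_insert hj, bilin_add_right, ih]

theorem bilin_mul (S : Matrix (Fin m) (Fin m) M) (a b : Fin m → R) (r s : R) :
    F.bilin S (fun i => a i * r) (fun k => b k * s) = F.act r s (F.bilin S a b) := by
  simp [bilin, F.act_mul, map_sum]

theorem tau_bilin (φ : MatPhi M Φ m) (a b : Fin m → R) :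
    F.tau (F.bilin (F.lamMat φ) a b) = F.bilin (F.lamMat φ) b a := by
  simp only [bilin, map_sum, ← F.tau_act, tau_lamMat]
  exact Finset.sum_comm

theorem quad_add_left (φ χ : MatPhi M Φ m) (a : Fin m → R) :
    F.quad (φ + χ) a = F.quad φ a + F.quad χ a := by
  simp only [quad, lamMat_add, map_add, Finset.sum_add_distrib, Prod.fst_add, Pi.add_apply]
  abel

theorem quad_zero_left (a : Fin m → R) : F.quad (0 : MatPhi M Φ m) a = 0 := by
  simp [quad, lamMat_zero]

theorem quad_add (φ : MatPhi M Φ m) (a b : Fin m → R) :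
    F.quad φ (a + b) = F.quad φ a + F.quad φ b + F.brace (F.bilin (F.lamMat φ) a b) := by
  have hb : F.brace (F.bilin (F.lamMat φ) a b)
      = ∑ i, (F.br (a i + b i) (φ.1 i) - F.br (a i) (φ.1 i) - F.br (b i) (φ.1 i))
        + ∑ i, ∑ k ∈ Finset.Ioi i, (F.brace (F.act (a i) (b k) (F.lamMat φ i k))
          + F.brace (F.act (b i) (a k) (F.lamMat φ i k))) := by
    rw [bilin, sum_eq_diag_add]
    simp only [map_add, map_sum, lamMat_self, F.brace_lam]
    congr 1
    refine Finset.sum_congr rfl fun i _ => Finset.sum_congr rfl fun k _ => ?_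
    rw [← F.tau_lamMat φ i k, F.tau_act, F.brace_tau]
  rw [hb]
  simp only [quad, Pi.add_apply, map_add, AddMonoidHom.add_apply, Finset.sum_add_distrib,
    Finset.sum_sub_distrib]
  abel

theorem quad_mul (φ : MatPhi M Φ m) (a : Fin m → R) (r : R) :
    F.quad φ (fun i => a i * r) = F.br r (F.quad φ a) := by
  simp [quad, F.br_mul, F.act_mul, F.brace_br, map_sum]

theorem quad_zero (φ : MatPhi M Φ m) : F.quad φ (0 : Fin m → R) = 0 := by
  simp [quad, br_zero]

theorem quad_sum (φ : MatPhi M Φ m) (a : Fin m → Fin m → R) (s : Finset (Fin m)) :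
    F.quad φ (∑ j ∈ s, a j) = ∑ j ∈ s, F.quad φ (a j)
      + ∑ j ∈ s, ∑ l ∈ s with j < l, F.brace (F.bilin (F.lamMat φ) (a j) (a l)) := by
  induction s using Finset.induction_on_max with
  | empty => simp [quad_zero]
  | insert x s hx ih =>
    have hxs : x ∉ s := fun h => lt_irrefl _ (hx x h)
    have h1 : (insert x s).filter (fun l => x < l) = ∅ := by
      ext l; simp only [Finset.mem_filter, Finset.mem_insert, Finset.notMem_empty, iff_false]
      rintro ⟨rfl | h, h'⟩
      · exact lt_irrefl _ h'
      · exact lt_asymm (hx l h) h'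
    have h2 : ∀ j ∈ s, ∑ l ∈ insert x s with j < l, F.brace (F.bilin (F.lamMat φ) (a j) (a l))
        = F.brace (F.bilin (F.lamMat φ) (a j) (a x))
          + ∑ l ∈ s with j < l, F.brace (F.bilin (F.lamMat φ) (a j) (a l)) := by
      intro j hj
      rw [Finset.filter_insert, if_pos (hx j hj), Finset.sum_insert (by simp [hxs])]
    rw [Finset.sum_insert hxs, Finset.sum_insert hxs, Finset.sum_insert hxs, h1,
      Finset.sum_congr rfl h2, Finset.sum_add_distrib, add_comm (a x), quad_add, ih,
      bilin_sum_left, map_sum]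
    simp only [Finset.sum_empty]
    abel

/-- The action `φ ↦ φ[A]` of a matrix `A` on upper triangular matrices. -/
def brMat (A : Matrix (Fin m) (Fin m) R) (φ : MatPhi M Φ m) : MatPhi M Φ m :=
  (fun j => F.quad φ (fun i => A i j),
    fun p => F.bilin (F.lamMat φ) (fun i => A i p.1.1) (fun i => A i p.1.2))

theorem lamMat_brMat (A : Matrix (Fin m) (Fin m) R) (φ : MatPhi M Φ m) (j l : Fin m) :
    F.lamMat (F.brMat A φ) j l = F.bilin (F.lamMat φ) (fun i => A i j) (fun i => A i l) := by
  rcases lt_trichotomy j l with h | h | h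
  · rw [lamMat_lt _ _ h]; rfl
  · subst h
    rw [lamMat_self, bilin, sum_eq_diag_add]
    simp only [brMat, quad, map_add, map_sum, F.lam_br, lamMat_self, F.lam_brace, ← F.tau_act,
      tau_lamMat]
  · rw [← tau_lamMat, lamMat_lt _ _ h]
    exact F.tau_bilin φ _ _

theorem lamMat_ext {φ χ : MatPhi M Φ m} (h1 : ∀ i, φ.1 i = χ.1 i)
    (h2 : ∀ i k, i < k → F.lamMat φ i k = F.lamMat χ i k) : φ = χ := by
  refine Prod.ext (funext h1) (funext ?_)
  rintro ⟨⟨i, k⟩, h⟩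
  have h' := h2 i k h
  rwa [lamMat_lt _ _ h, lamMat_lt _ _ h] at h'

/-- `{{S}}` for a matrix `S` over `M`: the entries `{{S_{ii}}}` on the diagonal and
`S_{ij} + τ(S_{ji})` above it. -/
def braceMat (S : Matrix (Fin m) (Fin m) M) : MatPhi M Φ m :=
  (fun i => F.brace (S i i), fun p => S p.1.1 p.1.2 + F.tau (S p.1.2 p.1.1))

theorem lamMat_braceMat (S : Matrix (Fin m) (Fin m) M) (i k : Fin m) :
    F.lamMat (F.braceMat S) i k = S i k + F.tau (S k i) := by
  rcases lt_trichotomy i k with h | h | h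
  · rw [lamMat_lt _ _ h]; rfl
  · subst h; rw [lamMat_self]; exact F.lam_brace _
  · rw [← tau_lamMat, lamMat_lt _ _ h]
    simp [braceMat, F.tau_tau, add_comm]

/-- The right action `S (A ⊗ B)` on matrices over `M`, with entries
`(S (A ⊗ B))_{jl} = ∑ S_{ik} (A_{ij} ⊗ B_{kl})`. -/
def actMat : Matrix (Fin m) (Fin m) R →+ Matrix (Fin m) (Fin m) R →+
    Matrix (Fin m) (Fin m) M →+ Matrix (Fin m) (Fin m) M :=
  AddMonoidHom.mk' (fun A => AddMonoidHom.mk' (fun B => AddMonoidHom.mk'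
    (fun S => Matrix.of fun j l => F.bilin S (fun i => A i j) (fun k => B k l))
    (by intro S T; ext j l; simp [bilin, Finset.sum_add_distrib]))
    (by intro B C; ext S j l; exact F.bilin_add_right S _ _ _))
    (by intro A B; ext C S j l; exact F.bilin_add_left S _ _ _)

theorem actMat_apply (A B : Matrix (Fin m) (Fin m) R) (S : Matrix (Fin m) (Fin m) M)
    (j l : Fin m) :
    F.actMat A B S j l = F.bilin S (fun i => A i j) (fun k => B k l) := rfl

/-- `τ(S)_{jl} = τ(S_{lj})` -/
def tauMat : Matrix (Fin m) (Fin m) M →+ Matrix (Fin m) (Fin m) M :=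
  AddMonoidHom.mk' (fun S => Matrix.of fun j l => F.tau (S l j)) (by intro S T; ext j l; simp)

theorem tauMat_apply (S : Matrix (Fin m) (Fin m) M) (j l : Fin m) :
    F.tauMat S j l = F.tau (S l j) := rfl

theorem bilin_one_left (S : Matrix (Fin m) (Fin m) M) (b : Fin m → R) (j : Fin m) :
    F.bilin S (fun i => (1 : Matrix (Fin m) (Fin m) R) i j) b = ∑ k, F.act 1 (b k) (S j k) := by
  rw [bilin, Finset.sum_eq_single j]
  · simp
  · intro i _ hi; simp [Matrix.one_apply_ne hi]
  · simp

theorem bilin_one_right (S : Matrix (Fin m) (Fin m) M) (a : Fin m → R) (l : Fin m) :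
    F.bilin S a (fun i => (1 : Matrix (Fin m) (Fin m) R) i l) = ∑ i, F.act (a i) 1 (S i l) := by
  rw [bilin]
  refine Finset.sum_congr rfl fun i _ => ?_
  rw [Finset.sum_eq_single l]
  · simp
  · intro k _ hk; simp [Matrix.one_apply_ne hk]
  · simp

theorem bilin_one_one (S : Matrix (Fin m) (Fin m) M) (j l : Fin m) :
    F.bilin S (fun i => (1 : Matrix (Fin m) (Fin m) R) i j)
      (fun i => (1 : Matrix (Fin m) (Fin m) R) i l) = S j l := by
  rw [bilin_one_left, Finset.sum_eq_single l]
  · simp [F.act_one]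
  · intro k _ hk; simp [Matrix.one_apply_ne hk]
  · simp

theorem col_mul (A B : Matrix (Fin m) (Fin m) R) (j : Fin m) :
    (fun i => (A * B) i j) = ∑ p, fun i => A i p * B p j := by
  ext i; simp [Matrix.mul_apply, Finset.sum_apply]

theorem actMat_mul (A A' B B' : Matrix (Fin m) (Fin m) R) (S : Matrix (Fin m) (Fin m) M) :
    F.actMat (A * A') (B * B') S = F.actMat A' B' (F.actMat A B S) := by
  ext j l
  rw [actMat_apply, col_mul, col_mul, bilin_sum_left]
  simp only [bilin_sum_right, bilin_mul]
  rfl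

theorem tauMat_actMat (A B : Matrix (Fin m) (Fin m) R) (S : Matrix (Fin m) (Fin m) M) :
    F.actMat B A (F.tauMat S) = F.tauMat (F.actMat A B S) := by
  ext j l
  simp only [actMat_apply, tauMat_apply, bilin, map_sum, ← F.tau_act]
  exact Finset.sum_comm

theorem brMat_add (A : Matrix (Fin m) (Fin m) R) (φ χ : MatPhi M Φ m) :
    F.brMat A (φ + χ) = F.brMat A φ + F.brMat A χ := by
  apply F.lamMat_ext
  · intro j; exact F.quad_add_left φ χ _
  · intro j l _
    simp [lamMat_brMat, lamMat_add, bilin, Finset.sum_add_distrib]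

theorem brMat_one (φ : MatPhi M Φ m) : F.brMat 1 φ = φ := by
  apply F.lamMat_ext
  · intro j
    simp only [brMat, quad]
    rw [Finset.sum_eq_single j, Finset.sum_eq_zero, add_zero]
    · simp [F.br_one]
    · intro i _
      refine Finset.sum_eq_zero fun k hk => ?_
      have hik : i ≠ k := ne_of_lt (Finset.mem_Ioi.1 hk)
      by_cases hi : i = j
      · subst hi; simp [Matrix.one_apply_ne (Ne.symm hik)]
      · simp [Matrix.one_apply_ne hi]
    · intro b _ hb; simp [Matrix.one_apply_ne hb, br_zero]
    · simp
  · intro j l _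
    rw [lamMat_brMat, bilin_one_one]

theorem brMat_mul (A B : Matrix (Fin m) (Fin m) R) (φ : MatPhi M Φ m) :
    F.brMat (A * B) φ = F.brMat B (F.brMat A φ) := by
  apply F.lamMat_ext
  · intro j
    change F.quad φ _ = F.quad (F.brMat A φ) _
    rw [col_mul, quad_sum]
    simp only [quad_mul, bilin_mul]
    conv_rhs => rw [quad]
    simp only [lamMat_brMat, Finset.filter_lt_eq_Ioi]
    rfl
  · intro j l _
    rw [lamMat_brMat, col_mul, col_mul, bilin_sum_left]
    simp only [bilin_sum_right, bilin_mul]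
    rw [lamMat_brMat, bilin]
    simp only [lamMat_brMat]

theorem braceMat_add (S T : Matrix (Fin m) (Fin m) M) :
    F.braceMat (S + T) = F.braceMat S + F.braceMat T := by
  apply F.lamMat_ext
  · intro i; simp [braceMat]
  · intro i k _; simp only [lamMat_add, lamMat_braceMat, Matrix.add_apply, map_add]; abel

theorem braceMat_actMat (A : Matrix (Fin m) (Fin m) R) (S : Matrix (Fin m) (Fin m) M) :
    F.braceMat (F.actMat A A S) = F.brMat A (F.braceMat S) := by
  apply F.lamMat_ext
  · intro j
    change F.brace (F.bilin S _ _) = F.quad (F.braceMat S) _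
    rw [bilin, sum_eq_diag_add, quad]
    simp only [map_add, map_sum, F.brace_br, lamMat_braceMat, F.tau_act, F.brace_tau]
    rfl
  · intro j l _
    rw [lamMat_braceMat, lamMat_brMat, actMat_apply, actMat_apply]
    simp only [bilin, lamMat_braceMat, map_add, map_sum, Finset.sum_add_distrib, F.tau_act]
    congr 1
    exact Finset.sum_comm

theorem braceMat_tauMat (S : Matrix (Fin m) (Fin m) M) :
    F.braceMat (F.tauMat S) = F.braceMat S := by
  apply F.lamMat_ext
  · intro i; exact F.brace_tau _
  · intro i k _
    simp only [lamMat_braceMat, tauMat_apply, F.tau_tau]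
    exact add_comm _ _

theorem braceMat_lamMat (A B : Matrix (Fin m) (Fin m) R) (φ : MatPhi M Φ m) :
    F.braceMat (F.actMat A B (F.lamMat φ))
      = F.brMat (A + B) φ - F.brMat A φ - F.brMat B φ := by
  have e : ∀ j, (fun i => (A + B) i j) = (fun i => A i j) + fun i => B i j := fun j => rfl
  rw [eq_sub_iff_add_eq, eq_sub_iff_add_eq]
  apply F.lamMat_ext
  · intro j
    change F.brace (F.bilin (F.lamMat φ) _ _) + F.quad φ _ + F.quad φ _ = F.quad φ _
    rw [e, quad_add]
    abel
  · intro j l _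
    simp only [lamMat_add, lamMat_braceMat, lamMat_brMat, actMat_apply, tau_bilin]
    rw [e, e, bilin_add_left, bilin_add_right, bilin_add_right]
    abel

theorem isUnit_epsMat : IsUnit ((F.psi.mapMatrix (m := Fin m) (n := Fin m)).symm
    (F.tauMat (F.psi.mapMatrix 1))) := by
  have h : (F.psi.mapMatrix (m := Fin m) (n := Fin m)).symm (F.tauMat (F.psi.mapMatrix 1))
      = Matrix.scalar (Fin m) (F.psi.symm (F.tau (F.psi 1))) := by
    rw [AddEquiv.symm_apply_eq]
    ext j l
    by_cases hjl : j = l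
    · subst hjl; simp [tauMat_apply]
    · simp [hjl, tauMat_apply, Matrix.one_apply_ne (Ne.symm hjl)]
  rw [h]
  exact F.isUnit_eps.map (Matrix.scalar (Fin m))

theorem mapMatrix_psi_mul (A B : Matrix (Fin m) (Fin m) R) :
    F.psi.mapMatrix (A * B) = F.actMat 1 B (F.psi.mapMatrix A) := by
  ext j l
  rw [actMat_apply, bilin_one_left]
  simp [Matrix.mul_apply, map_sum, F.psi_mul]

variable (m) in
/-- The form ring `Mat_m(R, M, ψ, Φ)`, with `ψ` acting entrywise. -/
def mat : FormRing (Matrix (Fin m) (Fin m) R) (Matrix (Fin m) (Fin m) M) (MatPhi M Φ m) where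
  act := F.actMat
  act_one S := by ext j l; exact F.bilin_one_one S j l
  act_mul A A' B B' S := F.actMat_mul A A' B B' S
  psi := F.psi.mapMatrix
  psi_mul A B := F.mapMatrix_psi_mul A B
  tau := F.tauMat
  tau_tau S := by ext j l; exact F.tau_tau _
  tau_act A B S := F.tauMat_actMat A B S
  isUnit_eps := F.isUnit_epsMat
  br A := AddMonoidHom.mk' (F.brMat A) (F.brMat_add A)
  br_one φ := F.brMat_one φ
  br_mul A B φ := F.brMat_mul A B φ
  brace := AddMonoidHom.mk' F.braceMat F.braceMat_add
  brace_br A S := F.braceMat_actMat A S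
  lam := AddMonoidHom.mk' F.lamMat (by intro φ χ; ext i k; exact F.lamMat_add φ χ i k)
  lam_br A φ := by ext j l; exact F.lamMat_brMat A φ j l
  brace_tau S := F.braceMat_tauMat S
  tau_lam φ := by ext i k; exact F.tau_lamMat φ k i
  lam_brace S := by ext i k; exact F.lamMat_braceMat S i k
  brace_lam A B φ := F.braceMat_lamMat A B φ

end Mat

/-! ### Finite representations -/

/-- A finite representation `ρ = (V, ρ_M, ρ_Φ, β)` of a form ring on the finite left
`R`-module `V`. -/
structure Rep {R M Φ : Type*} [Ring R] [AddCommGroup M] [AddCommGroup Φ] (F : FormRing R M Φ)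
    (V : Type*) [AddCommGroup V] [Module R V] [Fintype V] where
  rhoM : M →+ V →+ V →+ QZ
  rhoM_act : ∀ r s m x y, rhoM (F.act r s m) x y = rhoM m (r • x) (s • y)
  rhoM_tau : ∀ m x y, rhoM (F.tau m) x y = rhoM m y x
  /-- `β = ρ_M(ψ(1))` is non-singular -/
  nonsingular : Function.Bijective (rhoM (F.psi 1))
  rhoPhi : Φ →+ (V → QZ)
  rhoPhi_br : ∀ r φ x, rhoPhi (F.br r φ) x = rhoPhi φ (r • x)
  rhoPhi_brace : ∀ m x, rhoPhi (F.brace m) x = rhoM m x x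
  /-- this also says that each `ρ_Φ(φ)` is a quadratic map -/
  rhoM_lam : ∀ φ x y, rhoM (F.lam φ) x y = rhoPhi φ (x + y) - rhoPhi φ x - rhoPhi φ y

namespace Rep

variable {R M Φ V : Type*} [Ring R] [AddCommGroup M] [AddCommGroup Φ]
  [AddCommGroup V] [Module R V] [Fintype V] {F : FormRing R M Φ} (ρ : F.Rep V)

/-- The form `β = ρ_M(ψ(1))`. -/
def beta : V →+ V →+ QZ := ρ.rhoM (F.psi 1)

theorem beta_smul_left (r : R) (x y : V) : ρ.beta (r • x) y = ρ.beta x (F.J r • y) := by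
  have h1 := ρ.rhoM_act r 1 (F.psi 1) x y
  have h2 := ρ.rhoM_act 1 (F.J r) (F.psi 1) x y
  rw [F.act_psi_one, mul_one, h2] at h1
  simpa [beta] using h1.symm

/-- The orthogonal code `C^⊥ = {x | β(x, c) = 0 for all c ∈ C}`. -/
def perp (C : Submodule R V) : Submodule R V where
  carrier := {x | ∀ c ∈ C, ρ.beta x c = 0}
  add_mem' := by
    intro x y hx hy c hc
    rw [map_add, AddMonoidHom.add_apply, hx c hc, hy c hc, add_zero]
  zero_mem' := by intro c _; simp
  smul_mem' := by
    intro r x hx c hc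
    rw [beta_smul_left]
    exact hx _ (C.smul_mem _ hc)

/-- A code of Type `ρ`: a self-dual isotropic code in `ρ`. -/
def IsCodeOfType (C : Submodule R V) : Prop :=
  C = ρ.perp C ∧ ∀ φ : Φ, ∀ c ∈ C, ρ.rhoPhi φ c = 0

/-! ### Clifford-Weil groups -/

/-- `m_r : b_w ↦ b_{rw}` -/
def mOp (V : Type*) [AddCommGroup V] [Module R V] (r : Rˣ) : (V →₀ ℂ) →ₗ[ℂ] (V →₀ ℂ) :=
  Finsupp.linearCombination ℂ fun w => Finsupp.single ((r : R) • w) 1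

/-- `d_φ : b_w ↦ exp(2πi ρ_Φ(φ)(w)) b_w` -/
def dOp (φ : Φ) : (V →₀ ℂ) →ₗ[ℂ] (V →₀ ℂ) :=
  Finsupp.linearCombination ℂ fun w => qzExp (ρ.rhoPhi φ w) • Finsupp.single w 1

open Classical in
/-- The set `ιV`. -/
def idemImage (V : Type*) [AddCommGroup V] [Module R V] [Fintype V] (ι : R) : Finset V :=
  Finset.univ.image fun x : V => ι • x

/-- `h_{ι,u,v} : b_w ↦ |ιV|^{-1/2} ∑_{y ∈ ιV} exp(2πi β(y, v w)) b_{y + (1-ι)w}` -/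
def hOp (ι v : R) : (V →₀ ℂ) →ₗ[ℂ] (V →₀ ℂ) :=
  Finsupp.linearCombination ℂ fun w =>
    (((Real.sqrt ((idemImage V ι).card : ℝ))⁻¹ : ℝ) : ℂ) •
      ∑ y ∈ idemImage V ι, qzExp (ρ.beta y (v • w)) • Finsupp.single (y + (1 - ι) • w) 1

theorem mOp_bijective (r : Rˣ) : Function.Bijective (mOp V r) := by
  refine Function.bijective_iff_has_inverse.2 ⟨mOp V r⁻¹, fun x => ?_, fun x => ?_⟩
  · have h : mOp V r⁻¹ ∘ₗ mOp V r = LinearMap.id := by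
      ext1 w; ext1; simp [mOp, smul_smul]
    exact LinearMap.congr_fun h x
  · have h : mOp V r ∘ₗ mOp V r⁻¹ = LinearMap.id := by
      ext1 w; ext1; simp [mOp, smul_smul]
    exact LinearMap.congr_fun h x

theorem dOp_bijective (φ : Φ) : Function.Bijective (ρ.dOp φ) := by
  have h : ∀ χ : Φ, ρ.dOp (-χ) ∘ₗ ρ.dOp χ = LinearMap.id := by
    intro χ
    ext1 w; ext1
    simp [dOp, ← qzExp_add, qzExp_zero]
  refine Function.bijective_iff_has_inverse.2 ⟨ρ.dOp (-φ), fun x => ?_, fun x => ?_⟩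
  · exact LinearMap.congr_fun (h φ) x
  · have h' := h (-φ)
    rw [neg_neg] at h'
    exact LinearMap.congr_fun h' x

theorem beta_right_nondegenerate {y : V} (h : ∀ x, ρ.beta x y = 0) : y = 0 := by
  obtain ⟨e, he⟩ := F.isUnit_eps
  have hswap : ∀ a b, ρ.beta a b = ρ.beta b ((e : R) • a) := by
    intro a b
    have h1 := ρ.rhoM_tau (F.psi 1) b a
    have h2 := ρ.rhoM_act 1 (e : R) (F.psi 1) b a
    rw [← F.psi_mul, one_mul, he, AddEquiv.apply_symm_apply, h1, one_smul, ← he] at h2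
    exact h2
  have h0 : ((e⁻¹ : Rˣ) : R) • y = 0 := by
    apply ρ.nonsingular.1
    apply AddMonoidHom.ext
    intro x
    change ρ.beta _ x = ρ.rhoM _ 0 x
    rw [hswap, smul_smul, Units.mul_inv, one_smul, h]
    simp
  simpa [smul_smul] using congrArg (fun z => (e : R) • z) h0

open Classical in
theorem sum_qzExp_beta (ι : R) (z : V) :
    ∑ y ∈ idemImage V ι, qzExp (ρ.beta y z)
      = if F.J ι • z = 0 then ((idemImage V ι).card : ℂ) else 0 := by
  split_ifs with hz
  · rw [Finset.sum_congr rfl (g := fun _ => (1 : ℂ))]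
    · simp
    · intro y hy
      obtain ⟨x, -, rfl⟩ := Finset.mem_image.1 hy
      rw [beta_smul_left, hz, map_zero, qzExp_zero]
  · obtain ⟨x, hx⟩ : ∃ x, ρ.beta x (F.J ι • z) ≠ 0 := by
      by_contra! hcon
      exact hz (ρ.beta_right_nondegenerate hcon)
    have hx1 : qzExp (ρ.beta (ι • x) z) ≠ 1 := by
      intro h
      rw [beta_smul_left] at h
      exact hx (qzExp_eq_one h)
    have hshift : ∑ y ∈ idemImage V ι, qzExp (ρ.beta y z)
        = ∑ y ∈ idemImage V ι, qzExp (ρ.beta (ι • x) z) * qzExp (ρ.beta y z) := by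
      refine Finset.sum_bij' (fun y _ => y - ι • x) (fun y _ => y + ι • x) ?_ ?_ ?_ ?_ ?_
      · intro y hy
        obtain ⟨t, -, rfl⟩ := Finset.mem_image.1 hy
        exact Finset.mem_image.2 ⟨t - x, Finset.mem_univ _, smul_sub _ _ _⟩
      · intro y hy
        obtain ⟨t, -, rfl⟩ := Finset.mem_image.1 hy
        exact Finset.mem_image.2 ⟨t + x, Finset.mem_univ _, smul_add _ _ _⟩
      · intro y _; simp
      · intro y _; simp
      · intro y _
        rw [← qzExp_add, ← AddMonoidHom.add_apply, ← map_add]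
        congr 3; abel
    rw [← Finset.mul_sum] at hshift
    have h0 : (qzExp (ρ.beta (ι • x) z) - 1) * ∑ y ∈ idemImage V ι, qzExp (ρ.beta y z) = 0 := by
      rw [sub_mul, one_mul, ← hshift, sub_self]
    exact (mul_eq_zero.1 h0).resolve_left (sub_ne_zero.2 hx1)

theorem hOp_bijective {ι u v : R} (h : F.IsSymIdem ι u v) : Function.Bijective (ρ.hOp ι v) := by
  classical
  have hv1 : v * ι = v := by rw [← h.memV, mul_assoc, h.idem]
  have hv2 : F.J ι * v = v := by rw [← h.mulVU, mul_assoc, h.mulUV, hv1]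
  have hfix : ∀ y ∈ idemImage V ι, ι • y = y := by
    intro y hy
    obtain ⟨x, -, rfl⟩ := Finset.mem_image.1 hy
    rw [smul_smul, h.idem]
  have hJ : ∀ x : V, F.J ι • v • x = v • x := by intro x; rw [smul_smul, hv2]
  have hker : ∀ x : V, v • x = 0 ↔ ι • x = 0 := by
    intro x
    constructor
    · intro hx; rw [← h.mulUV, mul_smul, hx, smul_zero]
    · intro hx; rw [← hv1, mul_smul, hx, smul_zero]
  set c : ℂ := (((Real.sqrt ((idemImage V ι).card : ℝ))⁻¹ : ℝ) : ℂ) with hc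
  have hcard : 0 < (idemImage V ι).card :=
    Finset.card_pos.2 ⟨ι • 0, Finset.mem_image_of_mem _ (Finset.mem_univ _)⟩
  have hcc : c * c * ((idemImage V ι).card : ℂ) = 1 := by
    have h1 : (0 : ℝ) < ((idemImage V ι).card : ℝ) := by exact_mod_cast hcard
    have h2 : (Real.sqrt ((idemImage V ι).card : ℝ))⁻¹ * (Real.sqrt ((idemImage V ι).card : ℝ))⁻¹
        * ((idemImage V ι).card : ℝ) = 1 := by
      rw [← mul_inv, Real.mul_self_sqrt h1.le, inv_mul_cancel₀ h1.ne']
    rw [hc]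
    exact_mod_cast h2
  let k : (V →₀ ℂ) →ₗ[ℂ] (V →₀ ℂ) := Finsupp.linearCombination ℂ fun w =>
    c • ∑ y ∈ idemImage V ι, qzExp (-ρ.beta w (v • y)) • Finsupp.single (y + (1 - ι) • w) 1
  have hk : k ∘ₗ ρ.hOp ι v = LinearMap.id := by
    ext1 w
    ext1
    have hx1 : ∀ y ∈ idemImage V ι, (1 - ι) • (y + (1 - ι) • w) = (1 - ι) • w := by
      intro y hy
      have h1 : (1 - ι) * (1 - ι) = 1 - ι := by
        simp [mul_sub, sub_mul, h.idem]
      rw [smul_add, smul_smul, h1, sub_smul 1 ι y, one_smul, hfix y hy, sub_self, zero_add]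
    have hx2 : ∀ y y' : V, ρ.beta (y + (1 - ι) • w) (v • y') = ρ.beta y (v • y') := by
      intro y y'
      rw [map_add, AddMonoidHom.add_apply, sub_smul, one_smul, map_sub, AddMonoidHom.sub_apply,
        beta_smul_left, hJ, sub_self, add_zero]
    have hk1 : ∀ y ∈ idemImage V ι, k (Finsupp.single (y + (1 - ι) • w) 1)
        = c • ∑ y' ∈ idemImage V ι, qzExp (-ρ.beta y (v • y')) •
            Finsupp.single (y' + (1 - ι) • w) (1 : ℂ) := by
      intro y hy
      simp only [k, Finsupp.linearCombination_single, one_smul, hx1 y hy, hx2]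
    have hh : ρ.hOp ι v (Finsupp.single w 1) = c • ∑ y ∈ idemImage V ι,
        qzExp (ρ.beta y (v • w)) • Finsupp.single (y + (1 - ι) • w) 1 := by
      simp only [hOp, Finsupp.linearCombination_single, one_smul, hc]
    have hin : ∀ y' ∈ idemImage V ι, ∑ y ∈ idemImage V ι,
        qzExp (ρ.beta y (v • w)) * qzExp (-ρ.beta y (v • y'))
          = if y' = ι • w then ((idemImage V ι).card : ℂ) else 0 := by
      intro y' hy'
      have e : ∀ y, qzExp (ρ.beta y (v • w)) * qzExp (-ρ.beta y (v • y'))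
          = qzExp (ρ.beta y (v • (w - y'))) := by
        intro y
        rw [← qzExp_add, smul_sub, map_sub, sub_eq_add_neg]
      simp only [e]
      rw [sum_qzExp_beta, hJ]
      refine if_congr ?_ rfl rfl
      rw [hker, smul_sub, hfix y' hy', sub_eq_zero, eq_comm]
    change k (ρ.hOp ι v (Finsupp.single w 1)) = Finsupp.single w 1
    rw [hh, map_smul, map_sum]
    have hsum : ∑ y ∈ idemImage V ι,
        k (qzExp (ρ.beta y (v • w)) • Finsupp.single (y + (1 - ι) • w) 1)
        = c • ∑ y' ∈ idemImage V ι, (∑ y ∈ idemImage V ι,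
          qzExp (ρ.beta y (v • w)) * qzExp (-ρ.beta y (v • y'))) •
            Finsupp.single (y' + (1 - ι) • w) (1 : ℂ) := by
      rw [Finset.sum_congr rfl fun y hy => by rw [map_smul, hk1 y hy, smul_comm, Finset.smul_sum],
        ← Finset.smul_sum, Finset.sum_comm]
      simp only [smul_smul, ← Finset.sum_smul]
    rw [hsum, Finset.sum_congr rfl fun y' hy' => by rw [hin y' hy'], smul_smul]
    rw [Finset.sum_eq_single (ι • w)]
    · rw [if_pos rfl, smul_smul, hcc, one_smul, ← add_smul, add_sub_cancel, one_smul]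
    · intro y' _ hy'; rw [if_neg hy', zero_smul]
    · intro hw; exact absurd (Finset.mem_image_of_mem _ (Finset.mem_univ w)) hw
  have hinj : Function.Injective (ρ.hOp ι v) := by
    intro x y hxy
    have h1 := congrArg k hxy
    simpa using (LinearMap.congr_fun hk x).symm.trans (h1.trans (LinearMap.congr_fun hk y))
  exact ⟨hinj, LinearMap.injective_iff_surjective.1 hinj⟩

/-- The Clifford-Weil group `C(ρ)`, a group of linear automorphisms of `ℂV = (V →₀ ℂ)`, generated
by all `m_r`, `d_φ` and `h_{ι,u,v}`. These operators are invertible (`mOp_bijective`,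
`dOp_bijective`, `hOp_bijective`). Taking all symmetric idempotents with all choices of `u, v`
gives the same group as taking one choice for each `Rˣ`-conjugacy class: for a fixed `ι`, another
choice of `v` is `v r` for a unit `r` commuting with `ι`, which multiplies `h` by `m_r`. -/
def cliffordWeil : Subgroup ((V →₀ ℂ) ≃ₗ[ℂ] (V →₀ ℂ)) :=
  Subgroup.closure
    ({g | ∃ r : Rˣ, (g : (V →₀ ℂ) →ₗ[ℂ] (V →₀ ℂ)) = mOp V r}
      ∪ {g | ∃ φ : Φ, (g : (V →₀ ℂ) →ₗ[ℂ] (V →₀ ℂ)) = ρ.dOp φ}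
      ∪ {g | ∃ ι u v : R, F.IsSymIdem ι u v ∧
          (g : (V →₀ ℂ) →ₗ[ℂ] (V →₀ ℂ)) = ρ.hOp ι v})

/-! ### The Weight Enumerator Conjecture -/

open Classical in
/-- The full weight enumerator `∑_{c ∈ C} b_c ∈ ℂV`. -/
def fwe (C : Submodule R V) : V →₀ ℂ := ∑ c : V with c ∈ C, Finsupp.single c 1

/-- The space of vectors in `ℂV` fixed by the Clifford-Weil group. -/
def fixedSpace : Submodule ℂ (V →₀ ℂ) where
  carrier := {x | ∀ g ∈ ρ.cliffordWeil, g x = x}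
  add_mem' := by intro x y hx hy g hg; rw [map_add, hx g hg, hy g hg]
  zero_mem' := by intro g _; exact map_zero g
  smul_mem' := by intro c x hx g hg; rw [map_smul, hx g hg]

/-- The assertion of the Weight Enumerator Conjecture for `ρ`: the fixed space of `C(ρ)` in `ℂV`
is spanned by the full weight enumerators of the codes of Type `ρ`. -/
def WeightEnumeratorConjecture : Prop :=
  ρ.fixedSpace = Submodule.span ℂ {x | ∃ C, ρ.IsCodeOfType C ∧ x = fwe C}

/-! ### Orthogonal sums and higher genus -/

/-- The orthogonal sum `ρ^a` on `V^I` for a family of signs `a_i ∈ {1, -1}`. -/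
def orthSum {I : Type*} [Fintype I] [DecidableEq I] (a : I → ℤˣ) : F.Rep (I → V) where
  rhoM := AddMonoidHom.mk' (fun m => AddMonoidHom.mk' (fun x => AddMonoidHom.mk'
      (fun y => ∑ i, (a i : ℤ) • ρ.rhoM m (x i) (y i))
      (by intro y z; simp [Finset.sum_add_distrib]))
      (by intro x y; apply AddMonoidHom.ext; intro z; simp [Finset.sum_add_distrib]))
      (by
        intro m n; apply AddMonoidHom.ext; intro x; apply AddMonoidHom.ext; intro y
        simp [Finset.sum_add_distrib])
  rhoM_act r s m x y := by simp [ρ.rhoM_act]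
  rhoM_tau m x y := by simp [ρ.rhoM_tau]
  nonsingular := by
    constructor
    · intro x y h
      funext i
      apply ρ.nonsingular.1
      ext z
      have h' := DFunLike.congr_fun h (Pi.single i z)
      simp only [AddMonoidHom.mk'_apply] at h'
      rw [Finset.sum_eq_single i, Finset.sum_eq_single i] at h'
      · simp only [Pi.single_eq_same] at h'
        rcases Int.units_eq_one_or (a i) with ha | ha <;> simpa [ha] using h'
      all_goals simp +contextual
    · intro f
      choose g hg using ρ.nonsingular.2
      refine ⟨fun i => g ((a i : ℤ) • f.comp (AddMonoidHom.single (fun _ : I => V) i)), ?_⟩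
      apply AddMonoidHom.ext
      intro y
      simp only [AddMonoidHom.mk'_apply, hg]
      have hy : f y = ∑ i, f (Pi.single i (y i)) := by
        rw [← map_sum, Finset.univ_sum_single]
      rw [hy]
      refine Finset.sum_congr rfl fun i _ => ?_
      rcases Int.units_eq_one_or (a i) with ha | ha <;> simp [ha]
  rhoPhi := AddMonoidHom.mk' (fun φ x => ∑ i, (a i : ℤ) • ρ.rhoPhi φ (x i))
    (by intro φ χ; funext x; simp [Finset.sum_add_distrib])
  rhoPhi_br r φ x := by simp [ρ.rhoPhi_br]
  rhoPhi_brace m x := by simp [ρ.rhoPhi_brace]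
  rhoM_lam φ x y := by simp [ρ.rhoM_lam, Finset.sum_sub_distrib, smul_sub]

/-- `ρ^{(N,N)} = ρ^{(1^N, (-1)^N)}` on `V^{N+N}`; the codes of Type `(N,N)` are the codes of
this Type. -/
def typeNN (N : ℕ) : F.Rep (Fin N ⊕ Fin N → V) :=
  ρ.orthSum (Sum.elim (fun _ => 1) (fun _ => -1))

/-- The bi-additive map `(x, y) ↦ ∑ ρ_M(S_{ik})(x_i, y_k)` on `V^m`. -/
def genusM (m : ℕ) : Matrix (Fin m) (Fin m) M →+ (Fin m → V) →+ (Fin m → V) →+ QZ :=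
  AddMonoidHom.mk' (fun S => AddMonoidHom.mk' (fun x => AddMonoidHom.mk'
    (fun y => ∑ i, ∑ k, ρ.rhoM (S i k) (x i) (y k))
    (by intro y z; simp [Finset.sum_add_distrib]))
    (by intro x y; apply AddMonoidHom.ext; intro z; simp [Finset.sum_add_distrib]))
    (by
      intro m n; apply AddMonoidHom.ext; intro x; apply AddMonoidHom.ext; intro y
      simp [Finset.sum_add_distrib])

theorem genusM_apply {m : ℕ} (S : Matrix (Fin m) (Fin m) M) (x y : Fin m → V) :
    ρ.genusM m S x y = ∑ i, ∑ k, ρ.rhoM (S i k) (x i) (y k) := rfl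

/-- The quadratic map `x ↦ ∑ ρ_Φ(φ_i)(x_i) + ∑_{i<k} ρ_M(φ_{ik})(x_i, x_k)` on `V^m`. -/
def genusPhi (m : ℕ) : MatPhi M Φ m →+ ((Fin m → V) → QZ) :=
  AddMonoidHom.mk' (fun φ x => ∑ i, ρ.rhoPhi (φ.1 i) (x i)
      + ∑ i, ∑ k ∈ Finset.Ioi i, ρ.rhoM (F.lamMat φ i k) (x i) (x k))
    (by
      intro φ χ; funext x
      simp only [lamMat_add, Prod.fst_add, Pi.add_apply, map_add, AddMonoidHom.add_apply,
        Finset.sum_add_distrib]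
      abel)

theorem genusPhi_apply {m : ℕ} (φ : MatPhi M Φ m) (x : Fin m → V) :
    ρ.genusPhi m φ x = ∑ i, ρ.rhoPhi (φ.1 i) (x i)
      + ∑ i, ∑ k ∈ Finset.Ioi i, ρ.rhoM (F.lamMat φ i k) (x i) (x k) := rfl

theorem rhoPhi_zero (φ : Φ) : ρ.rhoPhi φ 0 = 0 := by
  have h := ρ.rhoM_lam φ 0 0
  simpa using h

theorem genusM_lamMat {m : ℕ} (φ : MatPhi M Φ m) (x y : Fin m → V) :
    ρ.genusM m (F.lamMat φ) x y
      = ρ.genusPhi m φ (x + y) - ρ.genusPhi m φ x - ρ.genusPhi m φ y := by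
  rw [genusM_apply, sum_eq_diag_add]
  have h : ∀ i k, ρ.rhoM (F.lamMat φ k i) (x k) (y i)
      = ρ.rhoM (F.lamMat φ i k) (y i) (x k) := by
    intro i k; rw [← F.tau_lamMat φ i k, ρ.rhoM_tau]
  simp only [h, lamMat_self, ρ.rhoM_lam, genusPhi_apply, Pi.add_apply, map_add,
    AddMonoidHom.add_apply, Finset.sum_add_distrib, Finset.sum_sub_distrib]
  abel

theorem genusPhi_sum {m : ℕ} (φ : MatPhi M Φ m) (x : Fin m → Fin m → V) (s : Finset (Fin m)) :
    ρ.genusPhi m φ (∑ j ∈ s, x j) = ∑ j ∈ s, ρ.genusPhi m φ (x j)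
      + ∑ j ∈ s, ∑ l ∈ s with j < l, ρ.genusM m (F.lamMat φ) (x j) (x l) := by
  have hadd : ∀ y z : Fin m → V, ρ.genusPhi m φ (y + z)
      = ρ.genusPhi m φ y + ρ.genusPhi m φ z + ρ.genusM m (F.lamMat φ) y z := by
    intro y z; rw [genusM_lamMat]; abel
  induction s using Finset.induction_on_max with
  | empty => simp [genusPhi_apply, rhoPhi_zero]
  | insert t s ht ih =>
    have hts : t ∉ s := fun h => lt_irrefl _ (ht t h)
    have h1 : (insert t s).filter (fun l => t < l) = ∅ := by
      ext l; simp only [Finset.mem_filter, Finset.mem_insert, Finset.notMem_empty, iff_false]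
      rintro ⟨rfl | h, h'⟩
      · exact lt_irrefl _ h'
      · exact lt_asymm (ht l h) h'
    have h2 : ∀ j ∈ s, ∑ l ∈ insert t s with j < l, ρ.genusM m (F.lamMat φ) (x j) (x l)
        = ρ.genusM m (F.lamMat φ) (x j) (x t)
          + ∑ l ∈ s with j < l, ρ.genusM m (F.lamMat φ) (x j) (x l) := by
      intro j hj
      rw [Finset.filter_insert, if_pos (ht j hj), Finset.sum_insert (by simp [hts])]
    rw [Finset.sum_insert hts, Finset.sum_insert hts, Finset.sum_insert hts, h1,
      Finset.sum_congr rfl h2, Finset.sum_add_distrib, add_comm (x t), hadd, ih,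
      map_sum, AddMonoidHom.finsetSum_apply]
    simp only [Finset.sum_empty]
    abel

theorem genusM_cols {m : ℕ} (S : Matrix (Fin m) (Fin m) M) (a b : Fin m → R) (v w : V) :
    ρ.genusM m S (fun i => a i • v) (fun i => b i • w) = ρ.rhoM (F.bilin S a b) v w := by
  simp [genusM_apply, bilin, map_sum, AddMonoidHom.finsetSum_apply, ρ.rhoM_act]

theorem genusPhi_col {m : ℕ} (φ : MatPhi M Φ m) (a : Fin m → R) (v : V) :
    ρ.genusPhi m φ (fun i => a i • v) = ρ.rhoPhi (F.quad φ a) v := by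
  simp [genusPhi_apply, quad, map_sum, Finset.sum_apply, ρ.rhoM_act, ρ.rhoPhi_br, ρ.rhoPhi_brace]

theorem genusM_smul {m : ℕ} (A B : Matrix (Fin m) (Fin m) R) (S : Matrix (Fin m) (Fin m) M)
    (x y : Fin m → V) :
    ρ.genusM m S (A • x) (B • y) = ρ.genusM m (F.actMat A B S) x y := by
  have hA : A • x = ∑ j, fun i => A i j • x j := by ext i; simp [Finset.sum_apply]
  have hB : B • y = ∑ j, fun i => B i j • y j := by ext i; simp [Finset.sum_apply]
  have h : ∀ (X Y : Fin m → Fin m → V), ρ.genusM m S (∑ j, X j) (∑ l, Y l)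
      = ∑ j, ∑ l, ρ.genusM m S (X j) (Y l) := by
    intro X Y
    simp only [map_sum, AddMonoidHom.finsetSum_apply]
    exact Finset.sum_comm
  rw [hA, hB, h]
  refine Finset.sum_congr rfl fun j _ => Finset.sum_congr rfl fun l _ => ?_
  exact ρ.genusM_cols S (fun i => A i j) (fun i => B i l) (x j) (y l)

/-- The representation `R^m ⊗ ρ` of the form ring `Mat_m(R, M, ψ, Φ)` on `V^m`. -/
def genus (m : ℕ) : (F.mat m).Rep (Fin m → V) where
  rhoM := ρ.genusM m
  rhoM_act A B S x y := by
    have h := ρ.genusM_smul A B S x y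
    exact h.symm
  rhoM_tau S x y := by
    change ∑ i, ∑ k, ρ.rhoM (F.tau (S k i)) (x i) (y k) = ∑ i, ∑ k, ρ.rhoM (S i k) (y i) (x k)
    simp only [ρ.rhoM_tau]
    exact Finset.sum_comm
  nonsingular := by
    have key : ρ.genusM m ((F.mat m).psi 1) = (ρ.orthSum fun _ => 1).rhoM (F.psi 1) := by
      apply AddMonoidHom.ext; intro x; apply AddMonoidHom.ext; intro y
      change ∑ i, ∑ k, ρ.rhoM (F.psi ((1 : Matrix (Fin m) (Fin m) R) i k)) (x i) (y k)
        = ∑ i, (((1 : ℤˣ) : ℤ)) • ρ.rhoM (F.psi 1) (x i) (y i)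
      refine Finset.sum_congr rfl fun i _ => ?_
      rw [Finset.sum_eq_single i]
      · simp
      · intro k _ hk; simp [Matrix.one_apply_ne (Ne.symm hk)]
      · simp
    rw [key]
    exact (ρ.orthSum fun _ => 1).nonsingular
  rhoPhi := ρ.genusPhi m
  rhoPhi_br A φ x := by
    have hA : A • x = ∑ j, fun i => A i j • x j := by ext i; simp [Finset.sum_apply]
    rw [hA, genusPhi_sum]
    simp only [genusM_cols, genusPhi_col, Finset.filter_lt_eq_Ioi]
    change ρ.genusPhi m (F.brMat A φ) x = _
    simp only [genusPhi_apply, lamMat_brMat]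
    rfl
  rhoPhi_brace S x := by
    change ρ.genusPhi m (F.braceMat S) x = _
    rw [genusM_apply, genusPhi_apply, sum_eq_diag_add]
    simp only [lamMat_braceMat, map_add, AddMonoidHom.add_apply, ρ.rhoM_tau]
    simp only [braceMat, ρ.rhoPhi_brace]
  rhoM_lam φ x y := ρ.genusM_lamMat φ x y

/-! ### Schur-Weyl duality -/

/-- The diagonal action of an operator `g` of `ℂU` on `W_N = ℂU^N = ⊗^N ℂU`, where
`b_w = b_{w_1} ⊗ ⋯ ⊗ b_{w_N}`: it maps `b_w` to `g b_{w_1} ⊗ ⋯ ⊗ g b_{w_N}`. -/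
def diagAction {U : Type*} [Fintype U] (N : ℕ) (g : (U →₀ ℂ) →ₗ[ℂ] (U →₀ ℂ)) :
    Module.End ℂ ((Fin N → U) →₀ ℂ) :=
  Finsupp.linearCombination ℂ fun w =>
    ∑ u : Fin N → U, (∏ i, g (Finsupp.single (w i) 1) (u i)) • Finsupp.single u 1

/-- The commuting algebra `End_{C(ρ)}(ℂV^N)` of the diagonal action of the Clifford-Weil group. -/
def commutingAlgebra (N : ℕ) : Subalgebra ℂ (Module.End ℂ ((Fin N → V) →₀ ℂ)) :=
  Subalgebra.centralizer ℂ
    {T | ∃ g ∈ ρ.cliffordWeil, T = diagAction N (g : (V →₀ ℂ) →ₗ[ℂ] (V →₀ ℂ))}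

/-- The identification of `ℂU^{N+N}` with `W_N ⊗ W_N^*`, mapping `b_{(x,y)}` to `b_x ⊗ b_y^*`,
where `b_y^*` are the elements of the dual basis. -/
def toTensorDual {U : Type*} (N : ℕ) :
    ((Fin N ⊕ Fin N → U) →₀ ℂ) →ₗ[ℂ]
      ((Fin N → U) →₀ ℂ) ⊗[ℂ] Module.Dual ℂ ((Fin N → U) →₀ ℂ) :=
  Finsupp.linearCombination ℂ fun w =>
    Finsupp.single (fun i => w (Sum.inl i)) 1 ⊗ₜ[ℂ] Finsupp.lapply (fun i => w (Sum.inr i))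

/-- The map `φ : W ⊗ W^* → End(W)`, `w ⊗ f ↦ (x ↦ f(x) w)`. -/
def tensorDualToEnd (W : Type*) [AddCommGroup W] [Module ℂ W] :
    W ⊗[ℂ] Module.Dual ℂ W →ₗ[ℂ] Module.End ℂ W :=
  dualTensorHom ℂ W W ∘ₗ (TensorProduct.comm ℂ W (Module.Dual ℂ W)).toLinearMap

theorem tensorDualToEnd_tmul {W : Type*} [AddCommGroup W] [Module ℂ W] (w : W)
    (f : Module.Dual ℂ W) (x : W) : tensorDualToEnd W (w ⊗ₜ f) x = f x • w := by
  simp [tensorDualToEnd]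

open Classical in
/-- The full genus-`m` weight enumerator `∑_{c ∈ C^m} b_{(c_i)_i}` of a code `C ≤ V^I`, where
`c_i ∈ V^m` is the `i`-th column of the matrix with rows `c^{(1)}, …, c^{(m)} ∈ C`. -/
def fweGenus {I : Type*} [Fintype I] (m : ℕ) (C : Submodule R (I → V)) :
    (I → Fin m → V) →₀ ℂ :=
  ∑ c : Fin m → I → V with ∀ j, c j ∈ C, Finsupp.single (fun i j => c j i) 1

end Rep
end FormRing
end

noncomputable section

open scoped Matrix

theorem star_qzExp (x : QZ) : star (qzExp x) = qzExp (-x) := by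
  induction x using QuotientAddGroup.induction_on with | H q
  rw [← QuotientAddGroup.mk_neg]
  change star (qzExp (q : QZ)) = qzExp ((-q : ℚ) : QZ)
  rw [qzExp_coe, qzExp_coe, Complex.star_def, ← Complex.exp_conj]
  simp [Complex.conj_ofNat]

theorem qzExp_sum {ι : Type*} (s : Finset ι) (f : ι → QZ) :
    qzExp (∑ i ∈ s, f i) = ∏ i ∈ s, qzExp (f i) := by
  classical
  induction s using Finset.induction_on with
  | empty => simp [qzExp_zero]
  | insert i s hi ih => rw [Finset.sum_insert hi, Finset.prod_insert hi, qzExp_add, ih]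

/-! ### Matrices of operators and Kronecker powers -/

/-- The matrix of an operator on `ℂU` in the basis `(b_w)`. -/
abbrev opMatrix {U : Type*} [Fintype U] [DecidableEq U] :
    Module.End ℂ (U →₀ ℂ) ≃ₐ[ℂ] Matrix U U ℂ :=
  LinearMap.toMatrixAlgEquiv Finsupp.basisSingleOne

theorem opMatrix_apply {U : Type*} [Fintype U] [DecidableEq U] (T : Module.End ℂ (U →₀ ℂ))
    (u w : U) : opMatrix T u w = T (Finsupp.single w 1) u := by
  simp [opMatrix, LinearMap.toMatrixAlgEquiv_apply]

theorem apply_eq_sum_opMatrix {U : Type*} [Fintype U] [DecidableEq U]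
    (T : Module.End ℂ (U →₀ ℂ)) (x : U →₀ ℂ) (u : U) :
    T x u = ∑ w, opMatrix T u w * x w := by
  conv_lhs => rw [← Finsupp.univ_sum_single x]
  rw [map_sum, Finsupp.finsetSum_apply]
  refine Finset.sum_congr rfl fun w _ => ?_
  rw [opMatrix_apply, ← mul_one (x w), ← smul_eq_mul, ← Finsupp.smul_single, map_smul]
  simp [mul_comm]

/-- The `κ`-fold Kronecker power of a square matrix. -/
def Matrix.tensorPow {U : Type*} (κ : Type*) [Fintype κ] (A : Matrix U U ℂ) :
    Matrix (κ → U) (κ → U) ℂ :=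
  Matrix.of fun u w => ∏ i, A (u i) (w i)

section TensorPow

variable {U κ : Type*} [Fintype κ]

theorem Matrix.tensorPow_apply (A : Matrix U U ℂ) (u w : κ → U) :
    A.tensorPow κ u w = ∏ i, A (u i) (w i) := rfl

/-- A product over `κ` of sums over `U` expands into a sum over functions `κ → U`, which are the
intermediate indices of the product on the right. -/
theorem Matrix.tensorPow_mul [Fintype U] [DecidableEq κ] (A B : Matrix U U ℂ) :
    (A * B).tensorPow κ = A.tensorPow κ * B.tensorPow κ := by
  ext u w
  simp only [tensorPow_apply, Matrix.mul_apply, Finset.prod_univ_sum, Fintype.piFinset_univ,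
    Finset.prod_mul_distrib]

theorem Matrix.tensorPow_one [DecidableEq U] [DecidableEq κ] :
    (1 : Matrix U U ℂ).tensorPow κ = 1 := by
  ext u w
  simp only [tensorPow_apply, Matrix.one_apply]
  by_cases h : u = w
  · simp [h]
  · obtain ⟨i, hi⟩ := Function.ne_iff.1 h
    rw [if_neg h]
    exact Finset.prod_eq_zero (Finset.mem_univ i) (if_neg hi)

theorem Matrix.tensorPow_conjTranspose (A : Matrix U U ℂ) :
    Aᴴ.tensorPow κ = (A.tensorPow κ)ᴴ := by
  ext u w
  simp [tensorPow_apply, Matrix.conjTranspose_apply]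

end TensorPow

namespace FormRing.Rep

/-! ### Tensors in `W ⊗ W^*` as endomorphisms of `W` -/

section Operators

variable {U : Type*} [Fintype U] [DecidableEq U]

/-- Reduces the multiplicativity of the diagonal action to that of Kronecker powers. -/
theorem opMatrix_diagAction (N : ℕ) (g : (U →₀ ℂ) →ₗ[ℂ] (U →₀ ℂ)) :
    opMatrix (diagAction N g) = (opMatrix g).tensorPow (Fin N) := by
  ext u w
  rw [opMatrix_apply, diagAction, Finsupp.linearCombination_single, one_smul,
    Finsupp.finsetSum_apply, Finset.sum_eq_single u]
  · simp [Matrix.tensorPow_apply, opMatrix_apply]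
  · intro t _ ht; simp [ht]
  · simp

theorem diagAction_mul (N : ℕ) (g h : Module.End ℂ (U →₀ ℂ)) :
    diagAction N (g * h) = diagAction N g * diagAction N h := by
  apply opMatrix.injective
  rw [map_mul, opMatrix_diagAction, opMatrix_diagAction, opMatrix_diagAction, map_mul,
    Matrix.tensorPow_mul]

theorem diagAction_one (N : ℕ) : diagAction N (1 : Module.End ℂ (U →₀ ℂ)) = 1 := by
  apply opMatrix.injective
  rw [map_one, opMatrix_diagAction, map_one, Matrix.tensorPow_one]

/-- The tensor `b_a ⊗ b_b^*` is sent to the matrix unit at `(a, b)`, so coefficients of `x` and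
matrix entries are the same data. -/
theorem opMatrix_tensorDualToEnd (N : ℕ) (x : (Fin N ⊕ Fin N → U) →₀ ℂ) (a b : Fin N → U) :
    opMatrix (tensorDualToEnd _ (toTensorDual N x)) a b = x (Sum.elim a b) := by
  rw [opMatrix_apply]
  induction x using Finsupp.induction_linear with
  | zero => simp
  | add x y hx hy => simp [hx, hy]
  | single w c =>
    have h : w = Sum.elim a b ↔ (fun i => w (Sum.inr i)) = b ∧ (fun i => w (Sum.inl i)) = a := by
      constructor
      · rintro rfl; simp
      · rintro ⟨rfl, rfl⟩; ext i; cases i <;> rfl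
    simp only [toTensorDual, Finsupp.linearCombination_single, map_smul, LinearMap.smul_apply,
      tensorDualToEnd_tmul, Finsupp.lapply_apply, Finsupp.smul_apply, Finsupp.single_apply, h]
    by_cases h1 : (fun i => w (Sum.inr i)) = b
    · by_cases h2 : (fun i => w (Sum.inl i)) = a <;> simp only [h1, h2] <;> simp
    · simp [h1, Ne.symm h1]

theorem tensorDualToEnd_toTensorDual_bijective (N : ℕ) :
    Function.Bijective fun x : (Fin N ⊕ Fin N → U) →₀ ℂ =>
      tensorDualToEnd _ (toTensorDual N x) := by
  constructor
  · intro x y h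
    ext w
    have h' := congrFun (congrFun (congrArg opMatrix h) fun i => w (Sum.inl i))
      fun i => w (Sum.inr i)
    simp only [opMatrix_tensorDualToEnd] at h'
    have hw : Sum.elim (fun i => w (Sum.inl i)) (fun i => w (Sum.inr i)) = w :=
      Sum.elim_comp_inl_inr w
    rwa [hw] at h'
  · intro T
    refine ⟨Finsupp.equivFunOnFinite.symm fun w =>
      opMatrix T (fun i => w (Sum.inl i)) (fun i => w (Sum.inr i)), ?_⟩
    apply opMatrix.injective
    ext a b
    rw [opMatrix_tensorDualToEnd]
    simp

/-- If `g` is unitary, then `g^{⊗N} ⊗ ḡ^{⊗N}` fixes `x` if and only if `g^{⊗N}` commutes with the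
endomorphism that corresponds to `x`. -/
theorem apply_eq_self_iff_commute {N : ℕ} {g : Module.End ℂ (U →₀ ℂ)}
    {g' : Module.End ℂ ((Fin N ⊕ Fin N → U) →₀ ℂ)}
    (hg : (opMatrix g)ᴴ * opMatrix g = 1)
    (hg' : ∀ u w, opMatrix g' u w = (∏ i, opMatrix g (u (Sum.inl i)) (w (Sum.inl i)))
      * ∏ i, star (opMatrix g (u (Sum.inr i)) (w (Sum.inr i))))
    (x : (Fin N ⊕ Fin N → U) →₀ ℂ) :
    g' x = x ↔ diagAction N g * tensorDualToEnd _ (toTensorDual N x)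
      = tensorDualToEnd _ (toTensorDual N x) * diagAction N g := by
  set A := (opMatrix g).tensorPow (Fin N) with hA
  have hAA : Aᴴ * A = 1 := by
    rw [hA, ← Matrix.tensorPow_conjTranspose, ← Matrix.tensorPow_mul, hg, Matrix.tensorPow_one]
  have hAA' : A * Aᴴ = 1 := mul_eq_one_comm.1 hAA
  -- The first `N` coordinates of the index contribute `A` on the left; the last `N`, being
  -- conjugated, contribute `Aᴴ` on the right.
  have key : opMatrix (tensorDualToEnd _ (toTensorDual N (g' x)))
      = A * opMatrix (tensorDualToEnd _ (toTensorDual N x)) * Aᴴ := by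
    ext a b
    rw [opMatrix_tensorDualToEnd, apply_eq_sum_opMatrix,
      ← (Equiv.sumArrowEquivProdArrow (Fin N) (Fin N) U).symm.sum_comp, Fintype.sum_prod_type,
      Finset.sum_comm, Matrix.mul_apply]
    refine Finset.sum_congr rfl fun d _ => ?_
    rw [Matrix.mul_apply, Finset.sum_mul]
    refine Finset.sum_congr rfl fun c _ => ?_
    rw [hg', opMatrix_tensorDualToEnd, Matrix.conjTranspose_apply, hA, Matrix.tensorPow_apply,
      Matrix.tensorPow_apply, star_prod]
    simp only [Sum.elim_inl, Sum.elim_inr, Equiv.sumArrowEquivProdArrow_symm_apply_inl,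
      Equiv.sumArrowEquivProdArrow_symm_apply_inr]
    change _ * x (Sum.elim c d) = _
    ring
  -- Both sides become matrix equations, `A X Aᴴ = X` and `A X = X A`, which are equivalent because
  -- `A` is unitary.
  rw [← (tensorDualToEnd_toTensorDual_bijective N).1.eq_iff, ← opMatrix.injective.eq_iff,
    ← opMatrix.injective.eq_iff (a := _ * _)]
  simp only [key, map_mul, opMatrix_diagAction, ← hA]
  constructor
  · intro h
    conv_rhs => rw [← h]
    rw [Matrix.mul_assoc _ Aᴴ, hAA, Matrix.mul_one]
  · intro h
    rw [h, Matrix.mul_assoc, hAA', Matrix.mul_one]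

end Operators

/-! ### Fixed vectors and commuting operators tested on generators -/

section Generators

variable {R M Φ V : Type*} [Ring R] [AddCommGroup M] [AddCommGroup Φ]
  [AddCommGroup V] [Module R V] [Fintype V] {F : FormRing R M Φ} (ρ : F.Rep V)

/-- The stabilizer of a vector is a subgroup, so the generators suffice. Their bijectivity makes
them elements of the group of linear automorphisms. -/
theorem mem_fixedSpace_iff {x : V →₀ ℂ} : x ∈ ρ.fixedSpace ↔
    (∀ r : Rˣ, mOp V r x = x) ∧ (∀ φ, ρ.dOp φ x = x) ∧
      ∀ ι u v, F.IsSymIdem ι u v → ρ.hOp ι v x = x := by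
  constructor
  · intro h
    refine ⟨fun r => ?_, fun φ => ?_, fun ι u v hι => ?_⟩
    · exact h (LinearEquiv.ofBijective _ (mOp_bijective r))
        (Subgroup.subset_closure (Or.inl (Or.inl ⟨r, rfl⟩)))
    · exact h (LinearEquiv.ofBijective _ (ρ.dOp_bijective φ))
        (Subgroup.subset_closure (Or.inl (Or.inr ⟨φ, rfl⟩)))
    · exact h (LinearEquiv.ofBijective _ (ρ.hOp_bijective hι))
        (Subgroup.subset_closure (Or.inr ⟨ι, u, v, hι, rfl⟩))
  · rintro ⟨hm, hd, hh⟩ g hg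
    induction hg using Subgroup.closure_induction with
    | mem g hg =>
      rcases hg with (⟨r, hr⟩ | ⟨φ, hφ⟩) | ⟨ι, u, v, hι, hv⟩
      · exact (LinearMap.congr_fun hr x).trans (hm r)
      · exact (LinearMap.congr_fun hφ x).trans (hd φ)
      · exact (LinearMap.congr_fun hv x).trans (hh ι u v hι)
    | one => rfl
    | mul g h _ _ hg hh => rw [LinearEquiv.mul_apply, hh, hg]
    | inv g _ hg => exact (LinearEquiv.symm_apply_eq g).2 hg.symm

/-- The condition on the whole group reduces to generators because the diagonal action is
multiplicative. -/
theorem mem_commutingAlgebra_iff {N : ℕ} {T : Module.End ℂ ((Fin N → V) →₀ ℂ)} :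
    T ∈ ρ.commutingAlgebra N ↔
    (∀ r : Rˣ, diagAction N (mOp V r) * T = T * diagAction N (mOp V r)) ∧
      (∀ φ, diagAction N (ρ.dOp φ) * T = T * diagAction N (ρ.dOp φ)) ∧
      ∀ ι u v, F.IsSymIdem ι u v →
        diagAction N (ρ.hOp ι v) * T = T * diagAction N (ρ.hOp ι v) := by
  classical
  rw [commutingAlgebra, Subalgebra.mem_centralizer_iff]
  constructor
  · intro h
    refine ⟨fun r => ?_, fun φ => ?_, fun ι u v hι => ?_⟩
    · exact h _ ⟨LinearEquiv.ofBijective _ (mOp_bijective r),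
        Subgroup.subset_closure (Or.inl (Or.inl ⟨r, rfl⟩)), rfl⟩
    · exact h _ ⟨LinearEquiv.ofBijective _ (ρ.dOp_bijective φ),
        Subgroup.subset_closure (Or.inl (Or.inr ⟨φ, rfl⟩)), rfl⟩
    · exact h _ ⟨LinearEquiv.ofBijective _ (ρ.hOp_bijective hι),
        Subgroup.subset_closure (Or.inr ⟨ι, u, v, hι, rfl⟩), rfl⟩
  · rintro ⟨hm, hd, hh⟩ _ ⟨g, hg, rfl⟩
    have hmul : ∀ g h : (V →₀ ℂ) ≃ₗ[ℂ] (V →₀ ℂ),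
        diagAction N ((g * h : (V →₀ ℂ) ≃ₗ[ℂ] (V →₀ ℂ)) : (V →₀ ℂ) →ₗ[ℂ] (V →₀ ℂ))
          = diagAction N (g : (V →₀ ℂ) →ₗ[ℂ] (V →₀ ℂ))
            * diagAction N (h : (V →₀ ℂ) →ₗ[ℂ] (V →₀ ℂ)) :=
      fun g h => diagAction_mul N (g : Module.End ℂ (V →₀ ℂ)) (h : Module.End ℂ (V →₀ ℂ))
    have hone : diagAction N ((1 : (V →₀ ℂ) ≃ₗ[ℂ] (V →₀ ℂ)) : (V →₀ ℂ) →ₗ[ℂ] (V →₀ ℂ)) = 1 :=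
      diagAction_one N
    induction hg using Subgroup.closure_induction with
    | mem g hg =>
      rcases hg with (⟨r, hr⟩ | ⟨φ, hφ⟩) | ⟨ι, u, v, hι, hv⟩
      · rw [hr]; exact hm r
      · rw [hφ]; exact hd φ
      · rw [hv]; exact hh ι u v hι
    | one => rw [hone, one_mul, mul_one]
    | mul g h _ _ hg hh => rw [hmul, mul_assoc, hh, ← mul_assoc, hg, mul_assoc]
    | inv g _ hg =>
      -- The diagonal actions of `g` and `g⁻¹` are mutually inverse, and an operator that commutes
      -- with a unit commutes with its inverse.
      have h1 := hmul g⁻¹ g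
      have h2 := hmul g g⁻¹
      rw [inv_mul_cancel, hone] at h1
      rw [mul_inv_cancel, hone] at h2
      refine Commute.eq ?_
      refine Commute.units_inv_left (u := ⟨_, _, h2.symm, h1.symm⟩) ?_
      exact hg

/-- `|ιV|^{-1/2}` -/
def hConst (V : Type*) [AddCommGroup V] [Module R V] [Fintype V] (ι : R) : ℂ :=
  (((Real.sqrt ((idemImage V ι).card : ℝ))⁻¹ : ℝ) : ℂ)

theorem mem_idemImage_iff {ι : R} (h : ι * ι = ι) {y : V} : y ∈ idemImage V ι ↔ ι • y = y := by
  classical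
  constructor
  · intro hy
    obtain ⟨x, -, rfl⟩ := Finset.mem_image.1 hy
    rw [smul_smul, h]
  · intro hy
    exact Finset.mem_image.2 ⟨y, Finset.mem_univ _, hy⟩

theorem idemImage_card_pos (ι : R) : 0 < (idemImage V ι).card := by
  classical
  exact Finset.card_pos.2 ⟨ι • 0, Finset.mem_image_of_mem _ (Finset.mem_univ _)⟩

theorem hConst_mul_self (ι : R) :
    hConst V ι * hConst V ι * ((idemImage V ι).card : ℂ) = 1 := by
  have h1 : (0 : ℝ) < ((idemImage V ι).card : ℝ) := by exact_mod_cast idemImage_card_pos ι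
  have h2 : (Real.sqrt ((idemImage V ι).card : ℝ))⁻¹ * (Real.sqrt ((idemImage V ι).card : ℝ))⁻¹
      * ((idemImage V ι).card : ℝ) = 1 := by
    rw [← mul_inv, Real.mul_self_sqrt h1.le, inv_mul_cancel₀ h1.ne']
  rw [hConst]
  exact_mod_cast h2

theorem star_hConst (ι : R) : star (hConst V ι) = hConst V ι := by
  simp [hConst]

/-- Because `ι^J = v u` and `u v = ι`, multiplying `v` by `ι^J` gives `v ι`, which is `v`. -/
theorem IsSymIdem.J_mul {ι u v : R} (h : F.IsSymIdem ι u v) : F.J ι * v = v := by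
  have hv1 : v * ι = v := by rw [← h.memV, mul_assoc, h.idem]
  rw [← h.mulVU, mul_assoc, h.mulUV, hv1]

/-- Moving `ι` across `β` turns it into `ι^J`, which `v` absorbs. The phase of `h_{ι,u,v}` can thus
be computed from the whole row index instead of its `ι`-component. -/
theorem beta_idem_smul {ι u v : R} (h : F.IsSymIdem ι u v) (x w : V) :
    ρ.beta (ι • x) (v • w) = ρ.beta x (v • w) := by
  rw [beta_smul_left, smul_smul, IsSymIdem.J_mul h]

/-! ### Matrices of the generators and their unitarity -/

variable [DecidableEq V]

theorem opMatrix_mOp (r : Rˣ) (u w : V) :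
    opMatrix (mOp V r) u w = if u = (r : R) • w then 1 else 0 := by
  rw [opMatrix_apply]
  simp [mOp, Finsupp.single_apply, eq_comm]

theorem opMatrix_dOp (φ : Φ) (u w : V) :
    opMatrix (ρ.dOp φ) u w = if u = w then qzExp (ρ.rhoPhi φ w) else 0 := by
  rw [opMatrix_apply]
  simp [dOp, Finsupp.single_apply, eq_comm]

/-- At most one summand reaches `b_a`: the equation `y + (1-ι)w = a` with `y ∈ ιV` forces `y = ιa`
and equal `(1-ι)`-components. A single conditional in place of a sum can then be multiplied
coordinatewise in `V^{N+N}`. -/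
theorem opMatrix_hOp {ι u v : R} (h : F.IsSymIdem ι u v) (a w : V) :
    opMatrix (ρ.hOp ι v) a w = if (1 - ι) • a = (1 - ι) • w then
      hConst V ι * qzExp (ρ.beta a (v • w)) else 0 := by
  have hmem : ∀ y ∈ idemImage V ι, (y + (1 - ι) • w = a ↔
      (1 - ι) • a = (1 - ι) • w ∧ y = ι • a) := by
    intro y hy
    rw [mem_idemImage_iff h.idem] at hy
    constructor
    · rintro rfl
      simp only [sub_smul, smul_add, smul_sub, one_smul, smul_smul, h.idem, hy]
      simp [sub_mul, h.idem]
    · rintro ⟨h1, rfl⟩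
      rw [← h1, ← add_smul]; simp
  rw [opMatrix_apply, hOp, Finsupp.linearCombination_single, one_smul, Finsupp.smul_apply,
    Finsupp.finsetSum_apply, smul_eq_mul]
  simp only [Finsupp.smul_apply, Finsupp.single_apply, smul_eq_mul, mul_ite, mul_one, mul_zero]
  rw [Finset.sum_congr rfl fun y hy => if_congr (hmem y hy) rfl rfl]
  split_ifs with hc
  · have hι : ι • a ∈ idemImage V ι := by
      rw [mem_idemImage_iff h.idem, smul_smul, h.idem]
    simp only [hc, true_and, Finset.sum_ite_eq', hι, if_true, ρ.beta_idem_smul h]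
    rfl
  · simp [hc]

theorem opMatrix_mOp_unitary (r : Rˣ) :
    (opMatrix (mOp V r))ᴴ * opMatrix (mOp V r) = 1 := by
  ext a b
  simp only [Matrix.mul_apply, Matrix.conjTranspose_apply, opMatrix_mOp, Matrix.one_apply]
  rw [Finset.sum_eq_single ((r : R) • a)]
  · have : (r : R) • a = (r : R) • b ↔ a = b := (r.isUnit.smul_left_cancel)
    simp [this]
  · intro c _ hc; simp [hc]
  · simp

theorem opMatrix_dOp_unitary (φ : Φ) :
    (opMatrix (ρ.dOp φ))ᴴ * opMatrix (ρ.dOp φ) = 1 := by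
  ext a b
  simp only [Matrix.mul_apply, Matrix.conjTranspose_apply, opMatrix_dOp, Matrix.one_apply]
  rw [Finset.sum_eq_single a]
  · by_cases hab : a = b
    · subst hab
      simp only [if_true, star_qzExp]
      rw [← qzExp_add, neg_add_cancel, qzExp_zero]
    · simp [hab]
  · intro c _ hc; simp [hc]
  · simp

/-- The matrix is block diagonal along the cosets of `ιV`, and each block is a normalized character
table; unitarity is orthogonality of characters. -/
theorem opMatrix_hOp_unitary {ι u v : R} (h : F.IsSymIdem ι u v) :
    (opMatrix (ρ.hOp ι v))ᴴ * opMatrix (ρ.hOp ι v) = 1 := by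
  ext a b
  simp only [Matrix.mul_apply, Matrix.conjTranspose_apply, opMatrix_hOp ρ h, Matrix.one_apply]
  by_cases hab : (1 - ι) • a = (1 - ι) • b
  swap
  · rw [if_neg fun e => hab (by rw [e])]
    refine Finset.sum_eq_zero fun c _ => ?_
    by_cases hc : (1 - ι) • c = (1 - ι) • a
    · rw [hc, if_neg hab, mul_zero]
    · simp [hc]
  have e : ∀ c : V, (star (if (1 - ι) • c = (1 - ι) • a then
        hConst V ι * qzExp (ρ.beta c (v • a)) else 0)
      * if (1 - ι) • c = (1 - ι) • b then hConst V ι * qzExp (ρ.beta c (v • b)) else 0)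
      = if (1 - ι) • c = (1 - ι) • a then
        hConst V ι * hConst V ι * qzExp (ρ.beta c (v • (b - a))) else 0 := by
    intro c
    rw [← hab]
    split_ifs with hc
    · rw [star_mul', star_hConst, star_qzExp, smul_sub, map_sub, sub_eq_neg_add, qzExp_add]
      ring
    · simp
  have hidem : (1 - ι) * (1 - ι) = 1 - ι := by simp [mul_sub, sub_mul, h.idem]
  -- The coset of `a` is parametrized by `ιV` via `c ↦ ιc`, which does not change the phase, so
  -- `sum_qzExp_beta` applies.
  have hsum : ∑ c : V with (1 - ι) • c = (1 - ι) • a, qzExp (ρ.beta c (v • (b - a)))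
      = ∑ y ∈ idemImage V ι, qzExp (ρ.beta y (v • (b - a))) := by
    refine Finset.sum_bij' (fun c _ => ι • c) (fun y _ => y + (1 - ι) • a) ?_ ?_ ?_ ?_ ?_
    · intro c _
      rw [mem_idemImage_iff h.idem, smul_smul, h.idem]
    · intro y hy
      rw [mem_idemImage_iff h.idem] at hy
      simp only [Finset.mem_filter, Finset.mem_univ, true_and]
      rw [smul_add, smul_smul, hidem, sub_smul, one_smul, hy]; simp
    · intro c hc
      rw [← (Finset.mem_filter.1 hc).2, ← add_smul]; simp
    · intro y hy
      rw [mem_idemImage_iff h.idem] at hy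
      rw [smul_add, hy, smul_smul, mul_sub, h.idem]; simp
    · intro c _
      rw [ρ.beta_idem_smul h]
  rw [Finset.sum_congr rfl fun c _ => e c, ← Finset.sum_filter, ← Finset.mul_sum, hsum,
    sum_qzExp_beta, smul_smul, IsSymIdem.J_mul h]
  -- From `u v = ι`, the kernel of `v` lies in that of `ι`; the `(1-ι)`-component of `b - a` already
  -- vanishes by `hab`.
  have hz : v • (b - a) = 0 ↔ a = b := by
    constructor
    · intro hv
      have h1 : ι • (b - a) = 0 := by rw [← h.mulUV, mul_smul, hv, smul_zero]
      have h2 : (1 - ι) • (b - a) = 0 := by rw [smul_sub, hab, sub_self]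
      have h3 : b - a = 0 := by
        rw [← one_smul R (b - a), ← sub_add_cancel (1 : R) ι, add_smul, h1, h2, add_zero]
      exact (sub_eq_zero.1 h3).symm
    · rintro rfl; simp
  split_ifs with h1 h2 h2
  · exact hConst_mul_self ι
  · exact absurd (hz.1 h1) h2
  · exact absurd (hz.2 h2) h1
  · rw [mul_zero]

end Generators

end FormRing.Rep

/-! ### Transport of a basis to a subalgebra -/

/-- A linear isomorphism that maps the span of a linearly independent family onto a subalgebra of
`End(W)` maps the family to a basis of the subalgebra. -/
theorem exists_basis_subalgebra {X W K : Type*} [AddCommGroup X] [Module ℂ X]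
    [AddCommGroup W] [Module ℂ W] {E : X →ₗ[ℂ] Module.End ℂ W}
    (hE : Function.Bijective E) {f : K → X} (hf : LinearIndependent ℂ f) {S : Subalgebra ℂ (Module.End ℂ W)}
    (hS : ∀ x, x ∈ Submodule.span ℂ (Set.range f) ↔ E x ∈ S) :
    ∃ b : Module.Basis K ℂ S, ∀ k, (b k : Module.End ℂ W) = E (f k) := by
  let b₀ : K → S := fun k => ⟨E (f k), (hS _).1 (Submodule.subset_span ⟨k, rfl⟩)⟩
  have hli : LinearIndependent ℂ b₀ :=
    LinearIndependent.of_comp S.val.toLinearMap (hf.map' E (LinearMap.ker_eq_bot.2 hE.1))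
  have htop : ⊤ ≤ Submodule.span ℂ (Set.range b₀) := by
    rintro ⟨T, hT⟩ -
    -- Surjectivity of `E` gives a preimage of `T`; the direction of `hS` from `S` back to the span
    -- puts it in the span of `f`.
    obtain ⟨x, rfl⟩ := hE.2 T
    have hy := Submodule.mem_map_of_mem (f := E) ((hS x).2 hT)
    rw [Submodule.map_span, ← Set.range_comp] at hy
    have he : Set.range (⇑E ∘ f) = S.val.toLinearMap '' Set.range b₀ := by
      rw [← Set.range_comp]; rfl
    rw [he, ← Submodule.map_span] at hy
    obtain ⟨y, hy, hyx⟩ := hy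
    rwa [show y = ⟨E x, hT⟩ from Subtype.ext hyx] at hy
  exact ⟨Module.Basis.mk hli htop, fun k => by rw [Module.Basis.mk_apply]⟩

namespace FormRing.Rep

/-! ### Generators for `ρ^{(N,N)}` as tensor products -/

section TypeNN

variable {R M Φ V : Type*} [Ring R] [AddCommGroup M] [AddCommGroup Φ]
  [AddCommGroup V] [Module R V] [Fintype V] {F : FormRing R M Φ} (ρ : F.Rep V) (N : ℕ)

theorem typeNN_rhoM (m : M) (x y : Fin N ⊕ Fin N → V) :
    (ρ.typeNN N).rhoM m x y = ∑ i, ρ.rhoM m (x (Sum.inl i)) (y (Sum.inl i))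
      + ∑ i, -ρ.rhoM m (x (Sum.inr i)) (y (Sum.inr i)) := by
  change ∑ i, ((Sum.elim (fun _ => 1) (fun _ => -1) : Fin N ⊕ Fin N → ℤˣ) i : ℤ) •
    ρ.rhoM m (x i) (y i) = _
  simp

theorem typeNN_rhoPhi (φ : Φ) (x : Fin N ⊕ Fin N → V) :
    (ρ.typeNN N).rhoPhi φ x = ∑ i, ρ.rhoPhi φ (x (Sum.inl i))
      + ∑ i, -ρ.rhoPhi φ (x (Sum.inr i)) := by
  change ∑ i, ((Sum.elim (fun _ => 1) (fun _ => -1) : Fin N ⊕ Fin N → ℤˣ) i : ℤ) •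
    ρ.rhoPhi φ (x i) = _
  simp

theorem sum_arrow_ext_iff {X : Type*} {a b : Fin N ⊕ Fin N → X} :
    a = b ↔ (∀ i, a (Sum.inl i) = b (Sum.inl i)) ∧ ∀ i, a (Sum.inr i) = b (Sum.inr i) := by
  rw [funext_iff, Sum.forall]

/-- Matrix entries of all three kinds of generators are values supported on a condition; this
collects the conditions of the `2N` coordinates into one. -/
theorem prod_ite_zero_mul_prod_ite_zero {κ : Type*} [Fintype κ] (p q : κ → Prop)
    [DecidablePred p] [DecidablePred q] [Decidable ((∀ i, p i) ∧ ∀ i, q i)] (f g : κ → ℂ) :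
    ((∏ i, if p i then f i else 0) * ∏ i, if q i then g i else 0)
      = if (∀ i, p i) ∧ ∀ i, q i then (∏ i, f i) * ∏ i, g i else 0 := by
  by_cases hp : ∀ i, p i
  · by_cases hq : ∀ i, q i
    · simp [hp, hq]
    · rw [if_neg fun h => hq h.2]
      obtain ⟨i, hi⟩ := not_forall.1 hq
      rw [Finset.prod_eq_zero (f := fun i => if q i then g i else 0) (Finset.mem_univ i)
        (if_neg hi), mul_zero]
  · rw [if_neg fun h => hp h.1]
    obtain ⟨i, hi⟩ := not_forall.1 hp
    rw [Finset.prod_eq_zero (f := fun i => if p i then f i else 0) (Finset.mem_univ i)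
      (if_neg hi), zero_mul]

theorem idemImage_pi_card {I : Type*} [Fintype I] [DecidableEq I] {ι : R} (h : ι * ι = ι) :
    (idemImage (I → V) ι).card = (idemImage V ι).card ^ Fintype.card I := by
  have e : idemImage (I → V) ι = Fintype.piFinset fun _ => idemImage V ι := by
    ext y
    simp only [mem_idemImage_iff h, Fintype.mem_piFinset, funext_iff, Pi.smul_apply]
  simp [e]

/-- Since `ι(V^I) = (ιV)^I`, the normalization factor is multiplicative over the coordinates. -/
theorem hConst_pi {I : Type*} [Fintype I] [DecidableEq I] {ι : R} (h : ι * ι = ι) :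
    hConst (I → V) ι = hConst V ι ^ Fintype.card I := by
  have hs : ∀ n : ℕ, √(((idemImage V ι).card : ℝ) ^ n) = √((idemImage V ι).card : ℝ) ^ n := by
    intro n
    rw [Real.sqrt_eq_iff_mul_self_eq (by positivity) (by positivity), ← mul_pow,
      Real.mul_self_sqrt (by positivity)]
  rw [hConst, hConst, idemImage_pi_card h]
  push_cast
  rw [hs]
  push_cast
  rw [inv_pow]

variable [DecidableEq V]

/-- Scalars act coordinatewise, and conjugation does nothing to entries that are 0 or 1. -/
theorem opMatrix_mOp_typeNN (r : Rˣ) (u w : Fin N ⊕ Fin N → V) :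
    opMatrix (mOp (Fin N ⊕ Fin N → V) r) u w
      = (∏ i, opMatrix (mOp V r) (u (Sum.inl i)) (w (Sum.inl i)))
        * ∏ i, star (opMatrix (mOp V r) (u (Sum.inr i)) (w (Sum.inr i))) := by
  simp only [opMatrix_mOp, apply_ite (star : ℂ → ℂ), star_zero]
  rw [prod_ite_zero_mul_prod_ite_zero]
  refine if_congr (sum_arrow_ext_iff N) ?_ rfl
  simp

/-- The sign `-1` on the last `N` coordinates is conjugation of the phase. -/
theorem opMatrix_dOp_typeNN (φ : Φ) (u w : Fin N ⊕ Fin N → V) :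
    opMatrix ((ρ.typeNN N).dOp φ) u w
      = (∏ i, opMatrix (ρ.dOp φ) (u (Sum.inl i)) (w (Sum.inl i)))
        * ∏ i, star (opMatrix (ρ.dOp φ) (u (Sum.inr i)) (w (Sum.inr i))) := by
  simp only [opMatrix_dOp, apply_ite (star : ℂ → ℂ), star_zero]
  rw [prod_ite_zero_mul_prod_ite_zero]
  refine if_congr (sum_arrow_ext_iff N) ?_ rfl
  rw [typeNN_rhoPhi, qzExp_add, qzExp_sum, qzExp_sum]
  simp only [star_qzExp]

/-- As for `d_φ`, negating `β` conjugates the phase; the factor `|ιV|^{-1/2}` is real, hence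
unaffected. -/
theorem opMatrix_hOp_typeNN {ι u v : R} (h : F.IsSymIdem ι u v) (a w : Fin N ⊕ Fin N → V) :
    opMatrix ((ρ.typeNN N).hOp ι v) a w
      = (∏ i, opMatrix (ρ.hOp ι v) (a (Sum.inl i)) (w (Sum.inl i)))
        * ∏ i, star (opMatrix (ρ.hOp ι v) (a (Sum.inr i)) (w (Sum.inr i))) := by
  simp only [opMatrix_hOp _ h, apply_ite (star : ℂ → ℂ), star_zero]
  rw [prod_ite_zero_mul_prod_ite_zero]
  refine if_congr (sum_arrow_ext_iff N) ?_ rfl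
  rw [beta, typeNN_rhoM, qzExp_add, qzExp_sum, qzExp_sum, hConst_pi h.idem]
  simp only [star_mul', star_qzExp, star_hConst, Finset.prod_mul_distrib, Finset.prod_const,
    Finset.card_univ, Fintype.card_sum, Fintype.card_fin, pow_add]
  change _ * ((∏ i, qzExp (ρ.beta (a (Sum.inl i)) (v • w (Sum.inl i))))
    * ∏ i, qzExp (-ρ.beta (a (Sum.inr i)) (v • w (Sum.inr i)))) = _
  ring

omit [DecidableEq V] in
/-- The fixed space of `C(ρ^{(N,N)})` corresponds to the commuting algebra of `C(ρ)` on `ℂV^N`. -/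
theorem mem_fixedSpace_typeNN_iff (x : (Fin N ⊕ Fin N → V) →₀ ℂ) :
    x ∈ (ρ.typeNN N).fixedSpace ↔
      tensorDualToEnd _ (toTensorDual N x) ∈ ρ.commutingAlgebra N := by
  classical
  rw [mem_fixedSpace_iff, mem_commutingAlgebra_iff]
  refine and_congr (forall_congr' fun r => ?_) (and_congr (forall_congr' fun φ => ?_)
    (forall_congr' fun ι => forall_congr' fun u => forall_congr' fun v =>
      forall_congr' fun h => ?_))
  · exact apply_eq_self_iff_commute (opMatrix_mOp_unitary r) (opMatrix_mOp_typeNN N r) x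
  · exact apply_eq_self_iff_commute (ρ.opMatrix_dOp_unitary φ) (ρ.opMatrix_dOp_typeNN N φ) x
  · exact apply_eq_self_iff_commute (ρ.opMatrix_hOp_unitary h) (ρ.opMatrix_hOp_typeNN N h) x

/-! ### Self-dual isotropic codes -/

/-- The code `{(x, x)}` in `V^{N+N}`. -/
def diagonalCode (R V : Type*) [Ring R] [AddCommGroup V] [Module R V] (N : ℕ) :
    Submodule R (Fin N ⊕ Fin N → V) where
  carrier := {x | ∀ i, x (Sum.inl i) = x (Sum.inr i)}
  add_mem' := by intro x y hx hy i; simp only [Pi.add_apply, hx i, hy i]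
  zero_mem' := by intro i; rfl
  smul_mem' := by intro r x hx i; simp only [Pi.smul_apply, hx i]

omit [DecidableEq V] in
-- The contributions of the two halves cancel, and non-singularity of `β` excludes further
-- orthogonal vectors. This code serves as the witness in genus 0, where no row is available to
-- recover a code from.
theorem isCodeOfType_diagonalCode : (ρ.typeNN N).IsCodeOfType (diagonalCode R V N) := by
  constructor
  · ext x
    constructor
    · intro hx c hc
      rw [beta, typeNN_rhoM, ← Finset.sum_add_distrib]
      refine Finset.sum_eq_zero fun i _ => ?_
      rw [hx i, hc i, add_neg_cancel]
    · intro hx i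
      apply ρ.nonsingular.1
      apply AddMonoidHom.ext
      intro v
      -- The test codeword has `v` at the two paired positions `i` and 0 elsewhere, so only the
      -- difference of the two entries of `x` is tested.
      have h := hx (Sum.elim (Pi.single i v) (Pi.single i v)) (fun i => rfl)
      rw [beta, typeNN_rhoM, Finset.sum_eq_single i, Finset.sum_eq_single i] at h
      · simp only [Sum.elim_inl, Sum.elim_inr, Pi.single_eq_same] at h
        exact add_neg_eq_zero.1 h
      all_goals simp +contextual
  · intro φ c hc
    rw [typeNN_rhoPhi, ← Finset.sum_add_distrib]
    refine Finset.sum_eq_zero fun i _ => ?_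
    rw [hc i, add_neg_cancel]

variable {ρ} in
omit [DecidableEq V] in
-- Taking orthogonals reverses the inclusion, and both codes are their own orthogonals.
theorem IsCodeOfType.eq_of_le {C D : Submodule R V} (hC : ρ.IsCodeOfType C)
    (hD : ρ.IsCodeOfType D) (h : C ≤ D) : C = D := by
  refine le_antisymm h ?_
  rw [hC.1, hD.1]
  exact fun x hx c hc => hx c (h hc)

variable {ρ} in
omit [DecidableEq V] in
-- Every element of `M` is `ψ(r) = ψ(1)(1 ⊗ r)`, so `ρ_M(m)(c, d) = β(c, rd)`, and `rd` is again a
-- codeword.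
theorem IsCodeOfType.rhoM_eq_zero {C : Submodule R V} (hC : ρ.IsCodeOfType C) (m : M) {c d : V}
    (hc : c ∈ C) (hd : d ∈ C) : ρ.rhoM m c d = 0 := by
  obtain ⟨r, rfl⟩ := F.psi.surjective m
  have h := F.psi_mul 1 r
  rw [one_mul] at h
  rw [h, ρ.rhoM_act, one_smul]
  rw [hC.1] at hc
  exact hc _ (C.smul_mem r hd)

end TypeNN

/-! ### Codes over the matrix form ring are powers `C^m` -/

section Morita

variable {R M Φ V : Type*} [Ring R] [AddCommGroup M] [AddCommGroup Φ]
  [AddCommGroup V] [Module R V] [Fintype V] {F : FormRing R M Φ} (ρ : F.Rep V) (N : ℕ)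

omit [Fintype V] in
theorem matrix_smul_apply {I : Type*} {m : ℕ} (A : Matrix (Fin m) (Fin m) R)
    (x : I → Fin m → V) (i : I) (j : Fin m) : (A • x) i j = ∑ k, A j k • x i k := by
  simp

/-- The code `C^m`, as a submodule of `(V^m)^I` over the matrix ring. -/
def powCode {I : Type*} (m : ℕ) (C : Submodule R (I → V)) :
    Submodule (Matrix (Fin m) (Fin m) R) (I → Fin m → V) where
  carrier := {x | ∀ j, (fun i => x i j) ∈ C}
  add_mem' := by intro x y hx hy j; exact C.add_mem (hx j) (hy j)
  zero_mem' := by intro j; exact C.zero_mem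
  smul_mem' := by
    intro A x hx j
    have h : (fun i => (A • x) i j) = ∑ k, A j k • fun i => x i k := by
      ext i; simp [matrix_smul_apply, Finset.sum_apply]
    change (fun i => (A • x) i j) ∈ C
    rw [h]
    exact C.sum_mem fun k _ => C.smul_mem _ (hx k)

omit [Fintype V] in
theorem mem_powCode {I : Type*} {m : ℕ} {C : Submodule R (I → V)} {x : I → Fin m → V} :
    x ∈ powCode m C ↔ ∀ j, (fun i => x i j) ∈ C := Iff.rfl

/-- Both sides sum over the same matrices, listed once by rows and once by columns. -/
theorem fweGenus_eq_fwe {I : Type*} [Fintype I] [DecidableEq I] (m : ℕ) (C : Submodule R (I → V)) :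
    fweGenus m C = fwe (powCode m C) := by
  classical
  rw [fweGenus, fwe]
  refine Finset.sum_bij' (fun c _ => fun i j => c j i) (fun c _ => fun j i => c i j)
    ?_ ?_ ?_ ?_ ?_ <;> simp [mem_powCode]

theorem fwe_apply (C : Submodule R V) [DecidablePred (· ∈ C)] (x : V) :
    fwe C x = if x ∈ C then 1 else 0 := by
  classical
  rw [fwe, Finsupp.finsetSum_apply]
  simp [Finsupp.single_apply, Finset.sum_ite_eq']

/-- The form of `R^m ⊗ ρ` comes from `ψ` of the identity matrix, which has no off-diagonal entries;
hence different rows do not interact. -/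
theorem genus_typeNN_beta {m : ℕ} (x y : Fin N ⊕ Fin N → Fin m → V) :
    ((ρ.genus m).typeNN N).beta x y
      = ∑ j, (ρ.typeNN N).beta (fun i => x i j) (fun i => y i j) := by
  have h : ∀ a b : Fin m → V, (ρ.genus m).rhoM ((F.mat m).psi 1) a b
      = ∑ j, ρ.rhoM (F.psi 1) (a j) (b j) := by
    intro a b
    change ∑ i, ∑ k, ρ.rhoM (F.psi ((1 : Matrix (Fin m) (Fin m) R) i k)) (a i) (b k) = _
    refine Finset.sum_congr rfl fun i _ => ?_
    rw [Finset.sum_eq_single i]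
    · simp
    · intro k _ hk; simp [Matrix.one_apply_ne (Ne.symm hk)]
    · simp
  simp only [beta, typeNN_rhoM, h, Finset.sum_add_distrib, Finset.sum_neg_distrib]
  rw [Finset.sum_comm, Finset.sum_comm (s := Finset.univ (α := Fin m))]
  congr 2
  exact Finset.sum_comm

theorem genus_typeNN_rhoPhi {m : ℕ} (φ : MatPhi M Φ m) (x : Fin N ⊕ Fin N → Fin m → V) :
    ((ρ.genus m).typeNN N).rhoPhi φ x
      = ∑ j, (ρ.typeNN N).rhoPhi (φ.1 j) (fun i => x i j)
        + ∑ j, ∑ k ∈ Finset.Ioi j,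
          (ρ.typeNN N).rhoM (F.lamMat φ j k) (fun i => x i j) (fun i => x i k) := by
  have h : ∀ a : Fin m → V, (ρ.genus m).rhoPhi φ a = ∑ j, ρ.rhoPhi (φ.1 j) (a j)
      + ∑ j, ∑ k ∈ Finset.Ioi j, ρ.rhoM (F.lamMat φ j k) (a j) (a k) := fun a => rfl
  have e1 : ∀ f : Fin m → Fin N → QZ, ∑ j, ∑ i, f j i = ∑ i, ∑ j, f j i :=
    fun f => Finset.sum_comm
  have e2 : ∀ f : Fin m → Fin m → Fin N → QZ, ∑ j, ∑ k ∈ Finset.Ioi j, ∑ i, f j k i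
      = ∑ i, ∑ j, ∑ k ∈ Finset.Ioi j, f j k i := by
    intro f
    rw [Finset.sum_comm]
    exact Finset.sum_congr rfl fun j _ => Finset.sum_comm
  simp only [typeNN_rhoPhi, typeNN_rhoM, h, Finset.sum_add_distrib, Finset.sum_neg_distrib, e1,
    e2]
  abel

/-- Orthogonality is checked row by row. The quadratic maps also involve pairs of distinct rows,
where `rhoM_eq_zero` is needed in addition to isotropy. -/
theorem isCodeOfType_powCode {m : ℕ} {C : Submodule R (Fin N ⊕ Fin N → V)}
    (hC : (ρ.typeNN N).IsCodeOfType C) : ((ρ.genus m).typeNN N).IsCodeOfType (powCode m C) := by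
  constructor
  · ext x
    constructor
    · intro hx y hy
      rw [genus_typeNN_beta]
      refine Finset.sum_eq_zero fun j _ => ?_
      have h := hx j
      rw [hC.1] at h
      exact h _ (hy j)
    · intro hx j
      rw [hC.1]
      intro c hc
      -- A matrix with the codeword `c` as its only nonzero row isolates row `j` of `x`.
      have h := hx (fun i => Pi.single j (c i)) (by
        intro k
        by_cases hk : k = j
        · subst hk; simpa using hc
        · simp only [Pi.single_eq_of_ne hk]
          exact C.zero_mem)
      rw [genus_typeNN_beta, Finset.sum_eq_single j] at h
      · simpa using h
      · intro k _ hk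
        simp only [Pi.single_eq_of_ne hk]
        exact map_zero _
      · simp
  · intro φ c hc
    rw [genus_typeNN_rhoPhi]
    rw [Finset.sum_eq_zero fun j _ => hC.2 _ _ (hc j), zero_add]
    exact Finset.sum_eq_zero fun j _ => Finset.sum_eq_zero fun k _ =>
      hC.rhoM_eq_zero _ (hc j) (hc k)

/-- The submodule of all `c` such that the matrix with `j`-th row `c` and all other rows `0`
is in `D`. -/
def rowCode {I : Type*} {m : ℕ} (j : Fin m)
    (D : Submodule (Matrix (Fin m) (Fin m) R) (I → Fin m → V)) : Submodule R (I → V) where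
  carrier := {c | (fun i => Pi.single j (c i)) ∈ D}
  add_mem' := by
    intro x y hx hy
    have h := D.add_mem hx hy
    simp only [Set.mem_ofPred_eq, Pi.add_apply, Pi.single_add]
    exact h
  zero_mem' := by
    simp only [Set.mem_ofPred_eq, Pi.zero_apply, Pi.single_zero]
    exact D.zero_mem
  smul_mem' := by
    intro r x hx
    have h := D.smul_mem (Matrix.single j j r) hx
    have e : (fun i => Pi.single j ((r • x) i) : I → Fin m → V)
        = Matrix.single j j r • fun i => Pi.single j (x i) := by
      ext i k
      rw [matrix_smul_apply, Finset.sum_eq_single j]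
      · by_cases hk : k = j
        · subst hk; simp
        · simp [hk, Ne.symm hk]
      · intro l _ hl; simp [hl]
      · simp
    simp only [Set.mem_ofPred_eq, e]
    exact h

omit [Fintype V] in
-- Closure under matrix units does the work: `E_{jk}` extracts row `k` of an element into row `j`,
-- and `E_{kj}` carries it back, so `D` is recovered by summing its rows. The choice of `j` is
-- immaterial.
theorem powCode_rowCode {I : Type*} {m : ℕ} (j : Fin m)
    (D : Submodule (Matrix (Fin m) (Fin m) R) (I → Fin m → V)) :
    powCode m (rowCode j D) = D := by
  have key : ∀ (x : I → Fin m → V) (k l : Fin m), (fun i => Pi.single k (x i l))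
      = Matrix.single k l (1 : R) • x := by
    intro x k l
    ext i p
    rw [matrix_smul_apply, Finset.sum_eq_single l]
    · by_cases hk : p = k
      · subst hk; simp
      · simp [hk, Ne.symm hk]
    · intro q _ hq; simp [Ne.symm hq]
    · simp
  ext x
  constructor
  · intro hx
    have h : x = ∑ k, Matrix.single k j (1 : R) • fun i => Pi.single j (x i k) := by
      have e : ∀ k, Matrix.single k j (1 : R) • (fun i => Pi.single j (x i k) : I → Fin m → V)
          = fun i => Pi.single k (x i k) := by
        intro k
        rw [← key]; simp
      simp only [e]
      ext i p
      simp [Finset.sum_apply, Pi.single_apply]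
    rw [h]
    exact D.sum_mem fun k _ => D.smul_mem _ (hx k)
  · intro hx k
    change (fun i => Pi.single j (x i k)) ∈ D
    rw [key]
    exact D.smul_mem _ hx

theorem exists_powCode_eq {m : ℕ}
    {D : Submodule (Matrix (Fin m) (Fin m) R) (Fin N ⊕ Fin N → Fin m → V)}
    (hD : ((ρ.genus m).typeNN N).IsCodeOfType D) :
    ∃ C, (ρ.typeNN N).IsCodeOfType C ∧ powCode m C = D := by
  rcases Nat.eq_zero_or_pos m with rfl | hm
  -- For `m = 0` the ambient module is zero, so the power of any code is `D`; only the existence of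
  -- a code of Type `(N,N)` matters.
  · refine ⟨diagonalCode R V N, ρ.isCodeOfType_diagonalCode N, ?_⟩
    ext x
    rw [Subsingleton.elim x 0]
    simp
  · let j : Fin m := ⟨0, hm⟩
    have hrow : ∀ c : Fin N ⊕ Fin N → V, c ∈ rowCode j D ↔ (fun i => Pi.single j (c i)) ∈ D :=
      fun c => Iff.rfl
    have hbeta : ∀ (c : Fin N ⊕ Fin N → V) (y : Fin N ⊕ Fin N → Fin m → V),
        ((ρ.genus m).typeNN N).beta (fun i => Pi.single j (c i)) y
          = (ρ.typeNN N).beta c fun i => y i j := by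
      intro c y
      rw [genus_typeNN_beta, Finset.sum_eq_single j]
      · simp
      · intro k _ hk
        simp only [Pi.single_eq_of_ne hk]
        exact DFunLike.congr_fun (map_zero (ρ.typeNN N).beta) _
      · simp
    refine ⟨rowCode j D, ⟨?_, ?_⟩, powCode_rowCode j D⟩
    · ext c
      have hDp := SetLike.ext_iff.1 hD.1 fun i => Pi.single j (c i)
      rw [hrow, hDp]
      constructor
      · intro h d hd
        have h' := h _ hd
        rw [hbeta] at h'
        simpa using h'
      · intro h y hy
        rw [hbeta]
        rw [← powCode_rowCode j D] at hy
        exact h _ (hy j)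
    · intro φ c hc
      -- The matrix form parameter has `φ` in diagonal position `j` and 0 elsewhere, so its value at
      -- the matrix with only row `c` is that of `φ` at `c`.
      have h := hD.2 (Pi.single j φ, 0) _ hc
      rw [genus_typeNN_rhoPhi, Finset.sum_eq_single j, Finset.sum_eq_zero, add_zero] at h
      · simpa using h
      · intro k _
        refine Finset.sum_eq_zero fun l hl => ?_
        rw [lamMat_lt _ _ (Finset.mem_Ioi.1 hl)]
        simp
      · intro k _ hk; simp [hk]
      · simp

/-! ### Linear independence of the weight enumerators -/

/-- If the codes of Type `(N,N)` are generated by `m` elements, then their genus-`m` full weight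
enumerators are linearly independent. -/
theorem linearIndependent_fweGenus {m : ℕ}
    (hm : ∀ C : Submodule R (Fin N ⊕ Fin N → V), (ρ.typeNN N).IsCodeOfType C →
      ∃ s : Fin m → (Fin N ⊕ Fin N → V), C = Submodule.span R (Set.range s)) :
    LinearIndependent ℂ fun C : {C : Submodule R (Fin N ⊕ Fin N → V) //
      (ρ.typeNN N).IsCodeOfType C} => fweGenus m C.1 := by
  classical
  rw [linearIndependent_iff']
  intro t f hf C hC
  obtain ⟨s, hs⟩ := hm C.1 C.2
  -- The matrix with rows the generators `s` of `C` lies in `D^m` exactly when `C ≤ D`, which forces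
  -- equality for self-dual codes.
  have hiff : ∀ D : {C : Submodule R (Fin N ⊕ Fin N → V) // (ρ.typeNN N).IsCodeOfType C},
      (fun i j => s j i) ∈ powCode m D.1 ↔ D = C := by
    intro D
    have h : (fun i j => s j i) ∈ powCode m D.1 ↔ C.1 ≤ D.1 := by
      rw [hs, Submodule.span_le, Set.range_subset_iff]
      exact Iff.rfl
    rw [h]
    exact ⟨fun h => (Subtype.ext (C.2.eq_of_le D.2 h)).symm, fun h => h ▸ le_rfl⟩
  -- At this matrix every weight enumerator except that of `C` vanishes, leaving the coefficient `f
  -- C`.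
  have h := DFunLike.congr_fun hf fun i j => s j i
  simp only [Finsupp.finsetSum_apply, Finsupp.smul_apply, fweGenus_eq_fwe, fwe_apply, hiff,
    smul_eq_mul, mul_ite, mul_one, mul_zero, Finset.sum_ite_eq', hC, if_true,
    Finsupp.zero_apply] at h
  exact h

/-- Padding a generating family with zeros leaves its span unchanged. -/
theorem exists_generators_of_le {W : Type*} [AddCommGroup W] [Module R W] {C : Submodule R W}
    {g m : ℕ} (hm : g ≤ m) (h : ∃ s : Fin g → W, C = Submodule.span R (Set.range s)) :
    ∃ s : Fin m → W, C = Submodule.span R (Set.range s) := by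
  obtain ⟨s, rfl⟩ := h
  refine ⟨fun j => if h : (j : ℕ) < g then s ⟨j, h⟩ else 0, le_antisymm ?_ ?_⟩
  · rw [Submodule.span_le, Set.range_subset_iff]
    intro i
    refine Submodule.subset_span ⟨Fin.castLE hm i, ?_⟩
    simp
  · rw [Submodule.span_le, Set.range_subset_iff]
    intro j
    by_cases h : (j : ℕ) < g
    · rw [dif_pos h]
      exact Submodule.subset_span ⟨_, rfl⟩
    · rw [dif_neg h]
      exact Submodule.zero_mem _

end Morita

end FormRing.Rep

end

/-! ### The basis of the commuting algebra -/

theorem mainTheorem5 {R M Φ V : Type*} [Ring R] [AddCommGroup M] [AddCommGroup Φ]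
    [AddCommGroup V] [Module R V] [Fintype V] (F : FormRing R M Φ) (ρ : F.Rep V)
    (N m g : ℕ)
    (hWEC : ((ρ.genus m).typeNN N).WeightEnumeratorConjecture)
    (hg : ∀ C : Submodule R (Fin N ⊕ Fin N → V), (ρ.typeNN N).IsCodeOfType C →
      ∃ s : Fin g → (Fin N ⊕ Fin N → V), C = Submodule.span R (Set.range s))
    (hm : g ≤ m) :
    (∃ b : Module.Basis {C : Submodule R (Fin N ⊕ Fin N → V) // (ρ.typeNN N).IsCodeOfType C} ℂ
        ((ρ.genus m).commutingAlgebra N),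
      ∀ C, (b C : Module.End ℂ ((Fin N → Fin m → V) →₀ ℂ)) =
        FormRing.Rep.tensorDualToEnd ((Fin N → Fin m → V) →₀ ℂ)
          (FormRing.Rep.toTensorDual N (FormRing.Rep.fweGenus m C.1))) ∧
    Module.finrank ℂ ((ρ.genus m).commutingAlgebra N) =
      Nat.card {C : Submodule R (Fin N ⊕ Fin N → V) // (ρ.typeNN N).IsCodeOfType C} := by
  classical
  set K := {C : Submodule R (Fin N ⊕ Fin N → V) // (ρ.typeNN N).IsCodeOfType C}
  let E : ((Fin N ⊕ Fin N → Fin m → V) →₀ ℂ) →ₗ[ℂ] Module.End ℂ ((Fin N → Fin m → V) →₀ ℂ) :=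
    FormRing.Rep.tensorDualToEnd _ ∘ₗ FormRing.Rep.toTensorDual N
  have hE : Function.Bijective E := FormRing.Rep.tensorDualToEnd_toTensorDual_bijective N
  have hspan : ((ρ.genus m).typeNN N).fixedSpace
      = Submodule.span ℂ (Set.range fun C : K => FormRing.Rep.fweGenus m C.1) := by
    -- The conjecture gives spanning by codes over the matrix ring; the correspondence `C ↔ C^m`
    -- rewrites the spanning set in terms of codes of Type `(N,N)`.
    refine hWEC.trans (congrArg _ ?_)
    ext x
    constructor
    · rintro ⟨D, hD, rfl⟩
      obtain ⟨C, hC, rfl⟩ := ρ.exists_powCode_eq N hD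
      exact ⟨⟨C, hC⟩, FormRing.Rep.fweGenus_eq_fwe m C⟩
    · rintro ⟨C, rfl⟩
      exact ⟨FormRing.Rep.powCode m C.1, ρ.isCodeOfType_powCode N C.2,
        FormRing.Rep.fweGenus_eq_fwe m C.1⟩
  have hli : LinearIndependent ℂ fun C : K => FormRing.Rep.fweGenus m C.1 :=
    ρ.linearIndependent_fweGenus N fun C hC =>
      FormRing.Rep.exists_generators_of_le hm (hg C hC)
  have hS : ∀ x, x ∈ Submodule.span ℂ (Set.range fun C : K => FormRing.Rep.fweGenus m C.1) ↔
      E x ∈ (ρ.genus m).commutingAlgebra N := by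
    intro x
    rw [← hspan]
    exact (ρ.genus m).mem_fixedSpace_typeNN_iff N x
  obtain ⟨b, hb⟩ := exists_basis_subalgebra hE hli hS
  exact ⟨⟨b, hb⟩, Module.finrank_eq_nat_card_basis b⟩
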